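/- Let $k$ be a field, $\bar k$ an algebraic closure of $k$, and $H$ a commutative affine group scheme over $k$ (not necessarily of finite type), with coordinate ring $\mathcal O(H)$. For such a group scheme, let $H\text{-mod}$ denote the category of finite-dimensional $H$-modules. A character of $H$ is a morphism of $\bar k$-group schemes $\chi : H_{\bar k} \to \mathbb G_{m,\bar k}$, viewed as an element of $\mathcal O(H)\otimes_k \bar k$; its field of definition $K = k(\chi)$ is the smallest subextension of $\bar k/k$ such that $\chi \in \mathcal O(H)\otimes_k K$ (it is a finite extension of $k$). Let $\rho(\chi)$ be the $H$-module with underlying $k$-vector space $K$, on which $H$ acts through the morphism $H \to \mathrm R_{K/k}(\mathbb G_{m,K})$ given by $\chi$ and multiplication in $K$, and let $H\text{-mod}_\chi$ be the full subcategory of $H\text{-mod}$ on the modules all of whose composition factors are isomorphic to $\rho(\chi)$. Let $U$ be the largest unipotent quotient group scheme of $H$, and $U_K$ its base change to $K$. Theorem. If $\chi$ is separable, that is, if $K/k$ is a separable field extension, then the abelian category $H\text{-mod}_\chi$ is equivalent to the abelian category $U_K\text{-mod}$ of finite-dimensional $U_K$-modules (by an additive, hence exact, equivalence). -/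

import Mathlib

open CategoryTheory
open scoped TensorProduct

universe u

/-!
An affine group scheme `H` over a field `k` is given by its coordinate ring `A = 𝒪(H)`, a
commutative Hopf algebra over `k`; it is commutative when `A` is cocommutative.
An `H`-module is a (right) `A`-comodule.
-/

noncomputable section

namespace AffGrp

section Representations

variable (k : Type u) [Field k] (A : Type u) [CommRing A] [HopfAlgebra k A]

/-- A finite-dimensional `H`-module, where `A = 𝒪(H)`: a finite-dimensional vector space with a
coassociative and counital coaction `V → V ⊗ A`. -/
structure FinRep where
  carrier : Type u
  [addCommGroup : AddCommGroup carrier]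
  [module : Module k carrier]
  [finite : Module.Finite k carrier]
  coact : carrier →ₗ[k] carrier ⊗[k] A
  coassoc : (TensorProduct.assoc k carrier A A).toLinearMap ∘ₗ coact.rTensor A ∘ₗ coact =
    (Coalgebra.comul (R := k) (A := A)).lTensor carrier ∘ₗ coact
  counit : (Coalgebra.counit (R := k) (A := A)).lTensor carrier ∘ₗ coact =
    (TensorProduct.rid k carrier).symm.toLinearMap

attribute [instance] FinRep.addCommGroup FinRep.module FinRep.finite

variable {k A}

namespace FinRep

/-- Morphisms of `H`-modules: the linear maps that commute with the coactions. -/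
@[ext]
structure Hom (V W : FinRep k A) where
  toLin : V.carrier →ₗ[k] W.carrier
  comm : W.coact ∘ₗ toLin = toLin.rTensor A ∘ₗ V.coact

/-- The category `H-mod` of finite-dimensional `H`-modules. -/
instance : Category (FinRep k A) where
  Hom := Hom
  id V := ⟨LinearMap.id, by simp⟩
  comp f g := ⟨g.toLin ∘ₗ f.toLin, by
    rw [← LinearMap.comp_assoc, g.comm, LinearMap.comp_assoc, f.comm, LinearMap.rTensor_comp,
      LinearMap.comp_assoc]⟩

/-- The linear map underlying a morphism of `H`-modules. -/
def lin {V W : FinRep k A} (f : V ⟶ W) : V.carrier →ₗ[k] W.carrier := Hom.toLin f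

theorem lin_comm {V W : FinRep k A} (f : V ⟶ W) :
    W.coact ∘ₗ lin f = (lin f).rTensor A ∘ₗ V.coact := Hom.comm f

/-- A linear map commuting with the coactions, as a morphism of `H`-modules. -/
def ofLin {V W : FinRep k A} (f : V.carrier →ₗ[k] W.carrier)
    (hf : W.coact ∘ₗ f = f.rTensor A ∘ₗ V.coact) : V ⟶ W := Hom.mk f hf

theorem lin_injective (V W : FinRep k A) :
    Function.Injective (lin : (V ⟶ W) → (V.carrier →ₗ[k] W.carrier)) :=
  fun _ _ h => Hom.ext h

section

variable (V W : FinRep k A)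

instance : Zero (V ⟶ W) := ⟨ofLin 0 (by simp)⟩
instance : Add (V ⟶ W) := ⟨fun f g => ofLin (lin f + lin g) (by
  rw [LinearMap.comp_add, lin_comm, lin_comm, LinearMap.rTensor_add, LinearMap.add_comp])⟩
instance : Neg (V ⟶ W) := ⟨fun f => ofLin (-lin f) (by
  rw [LinearMap.comp_neg, lin_comm, LinearMap.rTensor_neg, LinearMap.neg_comp])⟩
instance : Sub (V ⟶ W) := ⟨fun f g => ofLin (lin f - lin g) (by
  rw [LinearMap.comp_sub, lin_comm, lin_comm, LinearMap.rTensor_sub, LinearMap.sub_comp])⟩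
instance : SMul ℕ (V ⟶ W) := ⟨fun n f => ofLin (n • lin f) (by
  rw [LinearMap.comp_smul, lin_comm, ← LinearMap.coe_rTensorHom, map_nsmul, LinearMap.smul_comp])⟩
instance : SMul ℤ (V ⟶ W) := ⟨fun n f => ofLin (n • lin f) (by
  rw [LinearMap.comp_smul, lin_comm, ← LinearMap.coe_rTensorHom, map_zsmul, LinearMap.smul_comp])⟩

/-- Morphisms of `H`-modules are added as linear maps. -/
instance : AddCommGroup (V ⟶ W) :=
  (lin_injective V W).addCommGroup _ rfl (fun _ _ => rfl) (fun _ => rfl) (fun _ _ => rfl)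
    (fun _ _ => rfl) (fun _ _ => rfl)

end

instance : Preadditive (FinRep k A) where
  homGroup _ _ := inferInstance
  add_comp U _ W f f' g := lin_injective U W (LinearMap.comp_add (lin f) (lin f') (lin g))
  comp_add U _ W f g g' := lin_injective U W (LinearMap.add_comp (lin f) (lin g') (lin g))

/-- A subspace `W` of `V` is an `H`-submodule if the coaction maps `W` to `W ⊗ A`. -/
def IsSubmodule (V : FinRep k A) (W : Submodule k V.carrier) : Prop :=
  ∀ w ∈ W, V.coact w ∈ LinearMap.range (W.subtype.rTensor A)

/-- Simple (irreducible) `H`-modules. -/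
def IsSimple (V : FinRep k A) : Prop :=
  Nontrivial V.carrier ∧ ∀ W : Submodule k V.carrier, V.IsSubmodule W → W = ⊥ ∨ W = ⊤

/-- The composition factors of `V` are its simple subquotients: `X` is simple, and is a quotient
of some `H`-module `W` that embeds into `V`. -/
def IsCompositionFactor (X V : FinRep k A) : Prop :=
  X.IsSimple ∧ ∃ (W : FinRep k A) (i : W ⟶ V) (p : W ⟶ X),
    Function.Injective (lin i) ∧ Function.Surjective (lin p)

end FinRep

variable (k A) in
/-- `H` is unipotent: every nonzero `H`-module contains a nonzero `H`-fixed vector. -/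
def IsUnipotent : Prop :=
  ∀ V : FinRep k A, Nontrivial V.carrier → ∃ v : V.carrier, v ≠ 0 ∧ V.coact v = v ⊗ₜ[k] (1 : A)

end Representations

section Quotients

variable (k : Type u) [Field k] (A : Type u) [CommRing A] [HopfAlgebra k A]

/-- Hopf subalgebras of `A = 𝒪(H)`, i.e. (coordinate rings of) quotient group schemes of `H`. -/
structure HopfSubalgebra extends Subalgebra k A where
  comul_mem : ∀ a ∈ toSubalgebra, Bialgebra.comulAlgHom k A a ∈
    (Algebra.TensorProduct.map toSubalgebra.val toSubalgebra.val).range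
  antipode_mem : ∀ a ∈ toSubalgebra, HopfAlgebra.antipode k a ∈ toSubalgebra

variable {k A}

theorem map_val_injective (S T : Subalgebra k A) :
    Function.Injective (Algebra.TensorProduct.map S.val T.val) := by
  have := TensorProduct.map_injective_of_flat_flat S.val.toLinearMap T.val.toLinearMap
    Subtype.val_injective Subtype.val_injective
  exact this

namespace HopfSubalgebra

/-- The underlying ring of a Hopf subalgebra. -/
abbrev Carrier (S : HopfSubalgebra k A) : Type u := S.toSubalgebra

variable (S : HopfSubalgebra k A)

/-- The restriction of the comultiplication to a Hopf subalgebra. -/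
def comulHom : S.Carrier →ₐ[k] S.Carrier ⊗[k] S.Carrier :=
  (AlgEquiv.ofInjective _ (map_val_injective S.toSubalgebra S.toSubalgebra)).symm.toAlgHom.comp
    (((Bialgebra.comulAlgHom k A).comp S.val).codRestrict _ fun a => S.comul_mem a a.2)

theorem map_comulHom (a : S.Carrier) :
    Algebra.TensorProduct.map S.val S.val (S.comulHom a) = Coalgebra.comul (R := k) (a : A) := by
  have := (AlgEquiv.ofInjective _ (map_val_injective S.toSubalgebra S.toSubalgebra)).apply_symm_apply
    ((((Bialgebra.comulAlgHom k A).comp S.val).codRestrict _ fun a => S.comul_mem a a.2) a)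
  exact congrArg Subtype.val this

theorem map_comp_comulHom :
    (Algebra.TensorProduct.map S.val S.val).comp S.comulHom =
      (Bialgebra.comulAlgHom k A).comp S.val :=
  AlgHom.ext S.map_comulHom

theorem comulHom_coassoc :
    (Algebra.TensorProduct.assoc k k k S.Carrier S.Carrier S.Carrier).toAlgHom.comp
      ((Algebra.TensorProduct.map S.comulHom (.id k S.Carrier)).comp S.comulHom) =
    (Algebra.TensorProduct.map (.id k S.Carrier) S.comulHom).comp S.comulHom := by
  have hinj : Function.Injective
      (Algebra.TensorProduct.map S.val (Algebra.TensorProduct.map S.val S.val)) :=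
    TensorProduct.map_injective_of_flat_flat S.val.toLinearMap
      (Algebra.TensorProduct.map S.val S.val).toLinearMap Subtype.val_injective
      (map_val_injective S.toSubalgebra S.toSubalgebra)
  have e1 : (Algebra.TensorProduct.map S.val (Algebra.TensorProduct.map S.val S.val)).comp
      ((Algebra.TensorProduct.assoc k k k S.Carrier S.Carrier S.Carrier).toAlgHom.comp
        (Algebra.TensorProduct.map S.comulHom (.id k S.Carrier))) =
      (Algebra.TensorProduct.assoc k k k A A A).toAlgHom.comp
        ((Algebra.TensorProduct.map (Bialgebra.comulAlgHom k A) (.id k A)).comp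
          (Algebra.TensorProduct.map S.val S.val)) := by
    have h : (Algebra.TensorProduct.map S.val (Algebra.TensorProduct.map S.val S.val)).comp
        (Algebra.TensorProduct.assoc k k k S.Carrier S.Carrier S.Carrier).toAlgHom =
        (Algebra.TensorProduct.assoc k k k A A A).toAlgHom.comp
          (Algebra.TensorProduct.map (Algebra.TensorProduct.map S.val S.val) S.val) := by
      ext <;> simp [Algebra.TensorProduct.one_def]
    rw [← AlgHom.comp_assoc, h, AlgHom.comp_assoc, ← Algebra.TensorProduct.map_comp,
      ← Algebra.TensorProduct.map_comp, map_comp_comulHom]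
    rfl
  have e2 : (Algebra.TensorProduct.map S.val (Algebra.TensorProduct.map S.val S.val)).comp
      (Algebra.TensorProduct.map (.id k S.Carrier) S.comulHom) =
      (Algebra.TensorProduct.map (.id k A) (Bialgebra.comulAlgHom k A)).comp
        (Algebra.TensorProduct.map S.val S.val) := by
    rw [← Algebra.TensorProduct.map_comp, ← Algebra.TensorProduct.map_comp, map_comp_comulHom]
    rfl
  refine AlgHom.ext fun a => hinj ?_
  have h1 := DFunLike.congr_fun e1 (S.comulHom a)
  have h2 := DFunLike.congr_fun e2 (S.comulHom a)
  refine h1.trans (Eq.trans ?_ h2.symm)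
  simp only [AlgHom.comp_apply]
  rw [map_comulHom]
  exact Coalgebra.coassoc_apply (R := k) (a : A)

theorem comulHom_counit_left :
    (Algebra.TensorProduct.map ((Bialgebra.counitAlgHom k A).comp S.val) (.id k S.Carrier)).comp
      S.comulHom = (Algebra.TensorProduct.lid k S.Carrier).symm := by
  have hinj : Function.Injective (Algebra.TensorProduct.map (.id k k) S.val) :=
    TensorProduct.map_injective_of_flat_flat LinearMap.id S.val.toLinearMap
      Function.injective_id Subtype.val_injective
  have e1 : (Algebra.TensorProduct.map (.id k k) S.val).comp
      (Algebra.TensorProduct.map ((Bialgebra.counitAlgHom k A).comp S.val) (.id k S.Carrier)) =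
      (Algebra.TensorProduct.map (Bialgebra.counitAlgHom k A) (.id k A)).comp
        (Algebra.TensorProduct.map S.val S.val) := by
    ext <;> simp
  refine AlgHom.ext fun a => hinj ?_
  refine (DFunLike.congr_fun e1 (S.comulHom a)).trans ?_
  simp only [AlgHom.comp_apply]
  rw [map_comulHom]
  refine (Coalgebra.rTensor_counit_comul (R := k) (a : A)).trans ?_
  simp

theorem comulHom_counit_right :
    (Algebra.TensorProduct.map (.id k S.Carrier) ((Bialgebra.counitAlgHom k A).comp S.val)).comp
      S.comulHom = (Algebra.TensorProduct.rid k k S.Carrier).symm := by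
  have hinj : Function.Injective (Algebra.TensorProduct.map S.val (.id k k)) :=
    TensorProduct.map_injective_of_flat_flat S.val.toLinearMap LinearMap.id
      Subtype.val_injective Function.injective_id
  have e1 : (Algebra.TensorProduct.map S.val (.id k k)).comp
      (Algebra.TensorProduct.map (.id k S.Carrier) ((Bialgebra.counitAlgHom k A).comp S.val)) =
      (Algebra.TensorProduct.map (.id k A) (Bialgebra.counitAlgHom k A)).comp
        (Algebra.TensorProduct.map S.val S.val) := by
    ext <;> simp
  refine AlgHom.ext fun a => hinj ?_
  refine (DFunLike.congr_fun e1 (S.comulHom a)).trans ?_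
  simp only [AlgHom.comp_apply]
  rw [map_comulHom]
  refine (Coalgebra.lTensor_counit_comul (R := k) (a : A)).trans ?_
  simp

instance : Bialgebra k S.Carrier :=
  Bialgebra.ofAlgHom S.comulHom ((Bialgebra.counitAlgHom k A).comp S.val)
    S.comulHom_coassoc S.comulHom_counit_left S.comulHom_counit_right

/-- The restriction of the antipode to a Hopf subalgebra. -/
def antipodeHom : S.Carrier →ₗ[k] S.Carrier :=
  ((HopfAlgebra.antipode k (A := A)) ∘ₗ S.val.toLinearMap).codRestrict
    (Subalgebra.toSubmodule S.toSubalgebra) fun a => S.antipode_mem a a.2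

instance : HopfAlgebra k S.Carrier where
  antipode := S.antipodeHom
  mul_antipode_rTensor_comul := by
    have e : S.val.toLinearMap ∘ₗ LinearMap.mul' k S.Carrier ∘ₗ
        S.antipodeHom.rTensor S.Carrier =
        LinearMap.mul' k A ∘ₗ (HopfAlgebra.antipode k (A := A)).rTensor A ∘ₗ
          (Algebra.TensorProduct.map S.val S.val).toLinearMap := by
      ext; rfl
    refine LinearMap.ext fun a => Subtype.val_injective ?_
    refine (DFunLike.congr_fun e (S.comulHom a)).trans ?_
    simp only [LinearMap.comp_apply, AlgHom.toLinearMap_apply]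
    rw [map_comulHom]
    exact HopfAlgebra.mul_antipode_rTensor_comul_apply (R := k) (a : A)
  mul_antipode_lTensor_comul := by
    have e : S.val.toLinearMap ∘ₗ LinearMap.mul' k S.Carrier ∘ₗ
        S.antipodeHom.lTensor S.Carrier =
        LinearMap.mul' k A ∘ₗ (HopfAlgebra.antipode k (A := A)).lTensor A ∘ₗ
          (Algebra.TensorProduct.map S.val S.val).toLinearMap := by
      ext; rfl
    refine LinearMap.ext fun a => Subtype.val_injective ?_
    refine (DFunLike.congr_fun e (S.comulHom a)).trans ?_
    simp only [LinearMap.comp_apply, AlgHom.toLinearMap_apply]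
    rw [map_comulHom]
    exact HopfAlgebra.mul_antipode_lTensor_comul_apply (R := k) (a : A)

end HopfSubalgebra

variable (k A) in
/-- The antipode as an algebra homomorphism. -/
def antipodeAlg : A →ₐ[k] A :=
  AlgHom.ofLinearMap (HopfAlgebra.antipode k) HopfAlgebra.antipode_one fun a b => by
    rw [HopfAlgebra.antipode_mul_antidistrib, mul_comm]

variable (k A) in
/-- The coordinate ring of the largest unipotent quotient `U` of `H`: the Hopf subalgebra of
`𝒪(H)` generated by the coordinate rings of all unipotent quotients of `H`. -/
def unipotentQuotient : HopfSubalgebra k A where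
  toSubalgebra := ⨆ S : {S : HopfSubalgebra k A // IsUnipotent k S.Carrier}, S.1.toSubalgebra
  comul_mem := by
    set T : Subalgebra k A :=
      ⨆ S : {S : HopfSubalgebra k A // IsUnipotent k S.Carrier}, S.1.toSubalgebra with hT
    suffices h : T ≤ (Algebra.TensorProduct.map T.val T.val).range.comap
        (Bialgebra.comulAlgHom k A) from fun a ha => h ha
    refine iSup_le fun S a ha => ?_
    have hST : S.1.toSubalgebra ≤ T := le_iSup
      (fun S : {S : HopfSubalgebra k A // IsUnipotent k S.Carrier} => S.1.toSubalgebra) S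
    obtain ⟨z, hz⟩ := S.1.comul_mem a ha
    refine ⟨Algebra.TensorProduct.map (Subalgebra.inclusion hST) (Subalgebra.inclusion hST) z, ?_⟩
    refine Eq.trans ?_ hz
    refine DFunLike.congr_fun (?_ : (Algebra.TensorProduct.map T.val T.val).comp
      (Algebra.TensorProduct.map (Subalgebra.inclusion hST) (Subalgebra.inclusion hST)) = _) z
    rw [← Algebra.TensorProduct.map_comp]
    rfl
  antipode_mem := by
    set T : Subalgebra k A :=
      ⨆ S : {S : HopfSubalgebra k A // IsUnipotent k S.Carrier}, S.1.toSubalgebra with hT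
    suffices h : T ≤ T.comap (antipodeAlg k A) from fun a ha => h ha
    refine iSup_le fun S a ha => ?_
    exact le_iSup (fun S : {S : HopfSubalgebra k A // IsUnipotent k S.Carrier} =>
      S.1.toSubalgebra) S (S.1.antipode_mem a ha)

end Quotients

section Characters

variable {k : Type u} [Field k] {A : Type u} [CommRing A] [HopfAlgebra k A]
  {kbar : Type u} [Field kbar] [Algebra k kbar]

variable (k A kbar) in
/-- Characters of `H`: morphisms of group schemes from `H_{kbar}` to the multiplicative group
over `kbar`, i.e. morphisms of Hopf algebras `kbar[T, T⁻¹] → kbar ⊗ 𝒪(H)`. -/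
abbrev Character : Type u := LaurentPolynomial kbar →ₐc[kbar] kbar ⊗[k] A

namespace Character

/-- A character viewed as an element of `𝒪(H_{kbar}) = kbar ⊗ 𝒪(H)`. -/
def elt (χ : Character k A kbar) : kbar ⊗[k] A := χ (LaurentPolynomial.T 1)

/-- The character `χ` is defined over `L` if it lies in `L ⊗ 𝒪(H)`. -/
def IsDefinedOver (χ : Character k A kbar) (L : IntermediateField k kbar) : Prop :=
  χ.elt ∈ (Algebra.TensorProduct.map L.val (AlgHom.id k A)).range

/-- The field of definition `k(χ)`: the smallest subextension of `kbar/k` over which `χ` is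
defined. -/
def fieldOfDefinition (χ : Character k A kbar) : IntermediateField k kbar :=
  sInf {L | χ.IsDefinedOver L}

theorem isDefinedOver_iff {ι : Type*} (b : Module.Basis ι k A) (χ : Character k A kbar)
    (L : IntermediateField k kbar) :
    χ.IsDefinedOver L ↔ ∀ i, (Algebra.TensorProduct.basis kbar b).repr χ.elt i ∈ L := by
  constructor
  · rintro ⟨z, hz⟩ i
    rw [← hz]
    clear hz
    induction z with
    | zero => simp
    | add x y hx hy =>
      rw [map_add, map_add, Finsupp.add_apply]
      exact add_mem hx hy
    | tmul l a =>
      have : (Algebra.TensorProduct.map L.val (AlgHom.id k A)) (l ⊗ₜ[k] a) =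
        (l : kbar) ⊗ₜ[k] a := rfl
      change (Algebra.TensorProduct.basis kbar b).repr
        ((Algebra.TensorProduct.map L.val (AlgHom.id k A)) (l ⊗ₜ[k] a)) i ∈ L
      rw [this, Algebra.TensorProduct.basis_repr_tmul]
      simp only [Finsupp.smul_apply, Finsupp.mapRange_apply, smul_eq_mul]
      exact mul_mem l.2 (L.algebraMap_mem _)
  · intro h
    rw [IsDefinedOver, ← (Algebra.TensorProduct.basis kbar b).linearCombination_repr χ.elt,
      Finsupp.linearCombination_apply, Finsupp.sum]
    refine sum_mem fun i _ => ⟨(⟨_, h i⟩ : L) ⊗ₜ[k] b i, ?_⟩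
    simp [TensorProduct.smul_tmul']

theorem isDefinedOver_fieldOfDefinition (χ : Character k A kbar) :
    χ.IsDefinedOver χ.fieldOfDefinition := by
  let b := Module.Basis.ofVectorSpace k A
  rw [isDefinedOver_iff b]
  intro i
  rw [fieldOfDefinition, IntermediateField.mem_sInf]
  exact fun L hL => (isDefinedOver_iff b χ L).1 hL i

instance [Algebra.IsAlgebraic k kbar] (χ : Character k A kbar) :
    Module.Finite k χ.fieldOfDefinition := by
  let b := Module.Basis.ofVectorSpace k A
  let c := (Algebra.TensorProduct.basis kbar b).repr χ.elt
  let L := IntermediateField.adjoin k (c '' c.support)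
  have hL : χ.IsDefinedOver L := by
    rw [isDefinedOver_iff b]
    intro i
    by_cases hi : c i = 0
    · exact hi ▸ L.zero_mem
    · exact IntermediateField.subset_adjoin _ _ ⟨i, by simpa using hi, rfl⟩
  have hf : (c '' c.support).Finite := c.support.finite_toSet.image _
  have : Module.Finite k L := by
    have := hf.to_subtype
    exact IntermediateField.finiteDimensional_adjoin fun x _ => Algebra.IsIntegral.isIntegral x
  have hle : χ.fieldOfDefinition ≤ L := sInf_le hL
  exact Module.Finite.of_injective (IntermediateField.inclusion hle).toLinearMap
    (IntermediateField.inclusion hle).injective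

/-- The character `χ` as an element of `k(χ) ⊗ 𝒪(H)`. -/
def eltK (χ : Character k A kbar) : χ.fieldOfDefinition ⊗[k] A :=
  χ.isDefinedOver_fieldOfDefinition.choose

theorem map_eltK (χ : Character k A kbar) :
    Algebra.TensorProduct.map χ.fieldOfDefinition.val (AlgHom.id k A) χ.eltK = χ.elt :=
  χ.isDefinedOver_fieldOfDefinition.choose_spec

theorem elt_isGroupLike (χ : Character k A kbar) : IsGroupLikeElem kbar χ.elt := by
  refine IsGroupLikeElem.map χ ⟨?_, ?_⟩ <;> simp

/-- Multiples of an element `g` of `R ⊗ 𝒪(H)`. -/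
def mulMap {R : Type u} [CommRing R] [Algebra k R] (g : R ⊗[k] A) : R →ₗ[k] R ⊗[k] A :=
  (LinearMap.toSpanSingleton R _ g).restrictScalars k

theorem mulMap_apply {R : Type u} [CommRing R] [Algebra k R] (g : R ⊗[k] A) (x : R) :
    mulMap g x = x • g := rfl

theorem mulMap_coassoc {R : Type u} [CommRing R] [Algebra k R] {g : R ⊗[k] A}
    (hg : IsGroupLikeElem R g) :
    (TensorProduct.assoc k R A A).toLinearMap ∘ₗ (mulMap g).rTensor A ∘ₗ mulMap g =
      (Coalgebra.comul (R := k) (A := A)).lTensor R ∘ₗ mulMap g := by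
  let Φ := (TensorProduct.AlgebraTensorModule.distribBaseChange k R A A).symm
  have h1 : ∀ z : R ⊗[k] A, Φ (Coalgebra.comul (R := R) z) =
      (Coalgebra.comul (R := k) (A := A)).lTensor R z := by
    intro z
    induction z with
    | zero => simp
    | add x y hx hy => simp only [map_add, hx, hy]
    | tmul r a =>
      rw [TensorProduct.comul_tmul, LinearMap.lTensor_tmul]
      induction (Coalgebra.comul (R := k) a) with
      | zero => simp
      | add x y hx hy => simp only [TensorProduct.tmul_add, map_add, hx, hy]
      | tmul a b => simp [Φ]
  have h2 : ∀ z : R ⊗[k] A, Φ (g ⊗ₜ[R] z) =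
      TensorProduct.assoc k R A A ((mulMap g).rTensor A z) := by
    intro z
    induction z with
    | zero => simp
    | add x y hx hy => simp only [TensorProduct.tmul_add, map_add, hx, hy]
    | tmul r a =>
      rw [LinearMap.rTensor_tmul, mulMap_apply]
      clear hg h1
      induction g with
      | zero => simp
      | add x y hx hy =>
        simp only [TensorProduct.add_tmul, smul_add, map_add, hx, hy]
      | tmul r' b => simp [Φ, TensorProduct.smul_tmul', mul_comm]
  refine LinearMap.ext fun x => ?_
  simp only [LinearMap.comp_apply, LinearEquiv.coe_coe]
  rw [← h2, ← h1, mulMap_apply, TensorProduct.tmul_smul, map_smul, map_smul, map_smul,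
    hg.comul_eq_tmul_self]

theorem mulMap_counit {R : Type u} [CommRing R] [Algebra k R] {g : R ⊗[k] A}
    (hg : IsGroupLikeElem R g) :
    (Coalgebra.counit (R := k) (A := A)).lTensor R ∘ₗ mulMap g =
      (TensorProduct.rid k R).symm.toLinearMap := by
  have h1 : ∀ z : R ⊗[k] A, TensorProduct.rid k R
      ((Coalgebra.counit (R := k) (A := A)).lTensor R z) = Coalgebra.counit (R := R) z := by
    intro z
    induction z with
    | zero => simp
    | add x y hx hy => simp only [map_add, hx, hy]
    | tmul r a => simp
  refine LinearMap.ext fun x => (TensorProduct.rid k R).injective ?_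
  simp only [LinearMap.comp_apply, LinearEquiv.coe_coe, LinearEquiv.apply_symm_apply]
  rw [h1, mulMap_apply, map_smul, hg.counit_eq_one, smul_eq_mul, mul_one]

/-- The inclusion `k(χ) → kbar` as a `k`-linear map. -/
def incl (χ : Character k A kbar) : χ.fieldOfDefinition →ₗ[k] kbar :=
  χ.fieldOfDefinition.val.toLinearMap

theorem incl_mulMap (χ : Character k A kbar) :
    χ.incl.rTensor A ∘ₗ mulMap χ.eltK = mulMap χ.elt ∘ₗ χ.incl := by
  have h : ∀ (x : χ.fieldOfDefinition) (z : χ.fieldOfDefinition ⊗[k] A),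
      χ.incl.rTensor A (x • z) = χ.incl x • χ.incl.rTensor A z := by
    intro x z
    induction z with
    | zero => simp
    | add y z hy hz => simp only [smul_add, map_add, hy, hz]
    | tmul r a => rfl
  refine LinearMap.ext fun x => (h x χ.eltK).trans ?_
  exact congrArg (χ.incl x • ·) χ.map_eltK

theorem incl_rTensor_injective (χ : Character k A kbar) (V : Type u) [AddCommGroup V]
    [Module k V] : Function.Injective (χ.incl.rTensor V) :=
  Module.Flat.rTensor_preserves_injective_linearMap _ Subtype.val_injective

/-- The `H`-module `ρ(χ)`: the `k`-vector space `K = k(χ)`, on which `H` acts through the morphism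
from `H` to the Weil restriction of the multiplicative group of `K` that is given by `χ`, and
multiplication. So the coaction is `x ↦ x χ`. -/
def rep [Algebra.IsAlgebraic k kbar] (χ : Character k A kbar) : FinRep k A where
  carrier := χ.fieldOfDefinition
  coact := mulMap χ.eltK
  coassoc := by
    have e1 : χ.incl.rTensor (A ⊗[k] A) ∘ₗ
        (TensorProduct.assoc k χ.fieldOfDefinition A A).toLinearMap ∘ₗ
          (mulMap χ.eltK).rTensor A =
        (TensorProduct.assoc k kbar A A).toLinearMap ∘ₗ (mulMap χ.elt).rTensor A ∘ₗ
          χ.incl.rTensor A := by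
      rw [← LinearMap.rTensor_comp, ← incl_mulMap, LinearMap.rTensor_comp,
        ← LinearMap.comp_assoc, ← LinearMap.comp_assoc]
      congr 1
      ext; rfl
    have e2 : χ.incl.rTensor (A ⊗[k] A) ∘ₗ
        (Coalgebra.comul (R := k) (A := A)).lTensor χ.fieldOfDefinition =
        (Coalgebra.comul (R := k) (A := A)).lTensor kbar ∘ₗ χ.incl.rTensor A := by
      rw [LinearMap.rTensor_comp_lTensor, LinearMap.lTensor_comp_rTensor]
    refine LinearMap.ext fun x => χ.incl_rTensor_injective _ ?_
    have h1 := DFunLike.congr_fun e1 (mulMap χ.eltK x)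
    have h2 := DFunLike.congr_fun e2 (mulMap χ.eltK x)
    refine h1.trans (Eq.trans ?_ h2.symm)
    have h3 : χ.incl.rTensor A (mulMap χ.eltK x) = mulMap χ.elt (χ.incl x) :=
      DFunLike.congr_fun χ.incl_mulMap x
    simp only [LinearMap.comp_apply]
    rw [h3]
    exact DFunLike.congr_fun (mulMap_coassoc χ.elt_isGroupLike) (χ.incl x)
  counit := by
    refine LinearMap.ext fun x => χ.incl_rTensor_injective k ?_
    have e2 : χ.incl.rTensor k ∘ₗ
        (Coalgebra.counit (R := k) (A := A)).lTensor χ.fieldOfDefinition =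
        (Coalgebra.counit (R := k) (A := A)).lTensor kbar ∘ₗ χ.incl.rTensor A := by
      rw [LinearMap.rTensor_comp_lTensor, LinearMap.lTensor_comp_rTensor]
    refine (DFunLike.congr_fun e2 (mulMap χ.eltK x)).trans ?_
    have h3 : χ.incl.rTensor A (mulMap χ.eltK x) = mulMap χ.elt (χ.incl x) :=
      DFunLike.congr_fun χ.incl_mulMap x
    simp only [LinearMap.comp_apply]
    rw [h3]
    exact DFunLike.congr_fun (mulMap_counit χ.elt_isGroupLike) (χ.incl x)

/-- `χ` is separable if its field of definition is a separable extension of `k`. -/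
def IsSeparable (χ : Character k A kbar) : Prop :=
  Algebra.IsSeparable k χ.fieldOfDefinition

/-- The block `H-mod_χ`: the full subcategory of `H-mod` on the modules all of whose
composition factors are isomorphic to `ρ(χ)`. -/
abbrev Block [Algebra.IsAlgebraic k kbar] (χ : Character k A kbar) : Type (u + 1) :=
  ObjectProperty.FullSubcategory fun V : FinRep k A =>
    ∀ X : FinRep k A, X.IsCompositionFactor V → Nonempty (X ≅ χ.rep)

end Character

end Characters

end AffGrp

end

/-! Write `g` for `χ` viewed in `K ⊗ A`. A `U_K`-module `W` gives an `H`-module: let `H` act on `W`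
through its quotient `U`, multiply the coaction by `g`, and restrict scalars from `K` to `k`. This
functor `induce` is shown to be fully faithful with image the block of `χ`.

All arguments use that an `A`-comodule is a module over the convolution algebra `A^*`, which is
commutative since `A` is cocommutative. Evaluation at `g` is a ring homomorphism `A^* → K`,
surjective because `K` is the field of definition (`slice_eltK_surjective`). The coordinate ring of
`U` is the union of the filtration `fil` of `A` by iterated fixed vectors
(`unipotentQuotient_toSubalgebra`); a finite-dimensional comodule has its coefficients there exactly
when its own filtration by fixed vectors is exhaustive. Hence on an induced module each functional
`φ` acts as the scalar `g(φ) ∈ K` plus a nilpotent (`isNilpotent_induceAct_sub`), and every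
composition factor is `ρ(χ)`.

Separability enters twice. For fullness, a `k`-linear map commuting with operators "scalar plus
nilpotent" commutes with the semisimple parts, so it is `K`-linear (`map_smul_of_isNilpotent_sub`).
For essential surjectivity, let `V` be in the block. The commutative algebra generated by `A^*` on
`V` is `K` up to nilpotents, and Newton iteration lifts `K` into it
(`FinRep.exists_algHom_actAlgebra`). So `V` becomes a `K`-space; after twisting by `g⁻¹` each `φ`
acts as `φ(1)` plus a nilpotent, the filtration by fixed vectors is exhaustive
(`exists_fil_tw_eq_top`), and the twist is a `U_K`-module. -/

noncomputable section

namespace AffGrp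

/-! ### Contracting tensors with functionals. -/

section Slices

variable {k : Type*} [Field k] {V W C D : Type*} [AddCommGroup V] [Module k V]
  [AddCommGroup W] [Module k W] [AddCommGroup C] [Module k C] [AddCommGroup D] [Module k D]

variable (V) in
/-- Contraction of the right-hand factor of `V ⊗ C` with a functional. -/
def slice (φ : Module.Dual k C) : V ⊗[k] C →ₗ[k] V :=
  (TensorProduct.rid k V).toLinearMap ∘ₗ φ.lTensor V

@[simp]
theorem slice_tmul (φ : Module.Dual k C) (v : V) (c : C) : slice V φ (v ⊗ₜ c) = φ c • v := by
  simp [slice]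

theorem slice_rTensor (φ : Module.Dual k C) (f : V →ₗ[k] W) (z : V ⊗[k] C) :
    slice W φ (f.rTensor C z) = f (slice V φ z) := by
  induction z with
  | zero => simp
  | add x y hx hy => simp only [map_add, hx, hy]
  | tmul v c => simp

theorem slice_lTensor (φ : Module.Dual k D) (f : C →ₗ[k] D) (z : V ⊗[k] C) :
    slice V φ (f.lTensor V z) = slice V (φ ∘ₗ f) z := by
  induction z with
  | zero => simp
  | add x y hx hy => simp only [map_add, hx, hy]
  | tmul v c => simp

/-- The coordinate functionals of a basis of `C` already determine a tensor. -/
theorem slice_ext {z z' : V ⊗[k] C} (h : ∀ φ : Module.Dual k C, slice V φ z = slice V φ z') :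
    z = z' := by
  classical
  let b := Module.Basis.ofVectorSpace k C
  apply (TensorProduct.equivFinsuppOfBasisRight (M := V) b).injective
  ext i
  have key : ∀ x : V ⊗[k] C,
      TensorProduct.equivFinsuppOfBasisRight (M := V) b x i = slice V (b.coord i) x := by
    intro x
    induction x with
    | zero => simp
    | add x y hx hy => simp only [map_add, Finsupp.add_apply, hx, hy]
    | tmul v c => simp
  rw [key, key, h]

/-- By exactness, `N ⊗ C` is the kernel of the map to `(V ⧸ N) ⊗ C`, where tensors are separated by
slices. Stability under a coaction thus becomes stability under functionals. -/
theorem mem_range_rTensor_iff {N : Submodule k V} {z : V ⊗[k] C} :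
    z ∈ LinearMap.range (N.subtype.rTensor C) ↔ ∀ φ : Module.Dual k C, slice V φ z ∈ N := by
  constructor
  · rintro ⟨y, rfl⟩ φ
    rw [slice_rTensor]
    exact (slice N φ y).2
  · intro h
    have hz : N.mkQ.rTensor C z = 0 := slice_ext fun φ => by
      rw [slice_rTensor, map_zero]
      simpa using h φ
    have hex : Function.Exact (N.subtype.rTensor C) (N.mkQ.rTensor C) :=
      rTensor_exact C (LinearMap.exact_subtype_mkQ N) N.mkQ_surjective
    exact (hex z).1 hz

variable (C) in
/-- Contraction of the left-hand factor of `V ⊗ C` with a functional. -/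
def coslice (f : Module.Dual k V) : V ⊗[k] C →ₗ[k] C :=
  (TensorProduct.lid k C).toLinearMap ∘ₗ f.rTensor C

@[simp]
theorem coslice_tmul (f : Module.Dual k V) (v : V) (c : C) :
    coslice C f (v ⊗ₜ c) = f v • c := by
  simp [coslice]

theorem coslice_eq_slice_comm (f : Module.Dual k V) (z : V ⊗[k] C) :
    coslice C f z = slice C f (TensorProduct.comm k V C z) := by
  induction z with
  | zero => simp
  | add x y hx hy => simp only [map_add, hx, hy]
  | tmul v c => simp

theorem coslice_rTensor (f : Module.Dual k W) (g : V →ₗ[k] W) (z : V ⊗[k] C) :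
    coslice C f (g.rTensor C z) = coslice C (f ∘ₗ g) z := by
  induction z with
  | zero => simp
  | add x y hx hy => simp only [map_add, hx, hy]
  | tmul v c => simp

theorem coslice_lTensor (f : Module.Dual k V) (g : C →ₗ[k] D) (z : V ⊗[k] C) :
    coslice D f (g.lTensor V z) = g (coslice C f z) := by
  induction z with
  | zero => simp
  | add x y hx hy => simp only [map_add, hx, hy]
  | tmul v c => simp

theorem apply_slice (f : Module.Dual k V) (φ : Module.Dual k C) (z : V ⊗[k] C) :
    f (slice V φ z) = φ (coslice C f z) := by
  induction z with
  | zero => simp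
  | add x y hx hy => simp only [map_add, hx, hy]
  | tmul v c => simp [mul_comm]

theorem mem_range_lTensor_iff {N : Submodule k C} {z : V ⊗[k] C} :
    z ∈ LinearMap.range (N.subtype.lTensor V) ↔ ∀ f : Module.Dual k V, coslice C f z ∈ N := by
  simp_rw [coslice_eq_slice_comm, ← mem_range_rTensor_iff]
  have h : N.subtype.rTensor V ∘ₗ (TensorProduct.comm k V N).toLinearMap =
      (TensorProduct.comm k V C).toLinearMap ∘ₗ N.subtype.lTensor V := by
    ext; rfl
  constructor
  · rintro ⟨y, rfl⟩
    exact ⟨TensorProduct.comm k V N y, DFunLike.congr_fun h y⟩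
  · rintro ⟨y, hy⟩
    refine ⟨(TensorProduct.comm k V N).symm y, (TensorProduct.comm k V C).injective ?_⟩
    rw [← hy]
    refine (DFunLike.congr_fun h _).symm.trans ?_
    simp

/-- The intersection of `P ⊗ C` and `V ⊗ Q` is `P ⊗ Q`. -/
theorem mem_range_map_of_slice_of_coslice {P : Submodule k V} {Q : Submodule k C} {z : V ⊗[k] C}
    (hP : ∀ φ : Module.Dual k C, slice V φ z ∈ P) (hQ : ∀ f : Module.Dual k V, coslice C f z ∈ Q) :
    z ∈ LinearMap.range (TensorProduct.map P.subtype Q.subtype) := by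
  obtain ⟨y, rfl⟩ := mem_range_rTensor_iff.2 hP
  obtain ⟨p, hp⟩ := P.exists_isCompl
  have hy : ∀ f : Module.Dual k P, coslice C f y ∈ Q := fun f => by
    -- A functional on `P` is extended to `V` along a projection onto `P`.
    have := hQ (f ∘ₗ P.projectionOnto p hp)
    rw [coslice_rTensor, LinearMap.comp_assoc] at this
    have e : P.projectionOnto p hp ∘ₗ P.subtype = LinearMap.id := by ext; simp
    rwa [e, LinearMap.comp_id] at this
  obtain ⟨w, rfl⟩ := mem_range_lTensor_iff.2 hy
  refine ⟨w, ?_⟩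
  rw [← LinearMap.comp_apply, LinearMap.rTensor_comp_lTensor]

end Slices

/-! ### Functionals on the coalgebra as operators on a comodule. -/

section Actions

variable {k : Type*} [Field k] {V W C D : Type*} [AddCommGroup V] [Module k V]
  [AddCommGroup W] [Module k W] [AddCommGroup C] [Module k C] [AddCommGroup D] [Module k D]

/-- The action on a comodule of a functional on the coalgebra. -/
def act (δ : V →ₗ[k] V ⊗[k] C) (φ : Module.Dual k C) : V →ₗ[k] V := slice V φ ∘ₗ δ

theorem act_apply (δ : V →ₗ[k] V ⊗[k] C) (φ : Module.Dual k C) (v : V) :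
    act δ φ v = slice V φ (δ v) := rfl

theorem slice_slice_assoc_symm (φ ψ : Module.Dual k C) (z : V ⊗[k] (C ⊗[k] C)) :
    slice V φ (slice (V ⊗[k] C) ψ ((TensorProduct.assoc k V C C).symm z)) =
      slice V (LinearMap.mul' k k ∘ₗ TensorProduct.map φ ψ) z := by
  induction z with
  | zero => simp
  | add x y hx hy => simp only [map_add, hx, hy]
  | tmul v c =>
    induction c with
    | zero => simp
    | add x y hx hy => simp only [TensorProduct.tmul_add, map_add, hx, hy]
    | tmul c d => simp [smul_smul, mul_comm]

theorem act_act_eq (δ : V →ₗ[k] V ⊗[k] C) (φ ψ : Module.Dual k C) (v : V) :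
    act δ φ (act δ ψ v) = slice V φ (slice (V ⊗[k] C) ψ (δ.rTensor C (δ v))) := by
  rw [slice_rTensor]
  rfl

/-- A linear map commutes with the coactions if and only if it commutes with the actions of all
functionals. -/
theorem comm_coact_iff {δ : V →ₗ[k] V ⊗[k] C} {η : W →ₗ[k] W ⊗[k] C} {f : V →ₗ[k] W} :
    η ∘ₗ f = f.rTensor C ∘ₗ δ ↔ ∀ φ v, act η φ (f v) = f (act δ φ v) := by
  constructor
  · intro h φ v
    rw [act_apply, ← LinearMap.comp_apply η, h, LinearMap.comp_apply, slice_rTensor, act_apply]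
  · intro h
    refine LinearMap.ext fun v => slice_ext fun φ => ?_
    rw [LinearMap.comp_apply, LinearMap.comp_apply, slice_rTensor]
    exact h φ v

theorem act_lTensor (θ : C →ₗ[k] D) (δ : V →ₗ[k] V ⊗[k] C) (φ : Module.Dual k D) :
    act (θ.lTensor V ∘ₗ δ) φ = act δ (φ ∘ₗ θ) := by
  refine LinearMap.ext fun v => ?_
  rw [act_apply, LinearMap.comp_apply, slice_lTensor, act_apply]

/-- The coaction on a stable subspace. -/
def subCoact (δ : V →ₗ[k] V ⊗[k] C) (N : Submodule k V) (hN : ∀ φ, ∀ v ∈ N, act δ φ v ∈ N) :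
    N →ₗ[k] N ⊗[k] C :=
  (LinearEquiv.ofInjective (N.subtype.rTensor C)
    (Module.Flat.rTensor_preserves_injective_linearMap _ N.injective_subtype)).symm.toLinearMap ∘ₗ
    (δ ∘ₗ N.subtype).codRestrict _ fun n => mem_range_rTensor_iff.2 fun φ => hN φ n n.2

theorem subCoact_comm (δ : V →ₗ[k] V ⊗[k] C) (N : Submodule k V)
    (hN : ∀ φ, ∀ v ∈ N, act δ φ v ∈ N) :
    δ ∘ₗ N.subtype = N.subtype.rTensor C ∘ₗ subCoact δ N hN := by
  refine LinearMap.ext fun n => ?_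
  exact (congrArg Subtype.val ((LinearEquiv.ofInjective (N.subtype.rTensor C)
    (Module.Flat.rTensor_preserves_injective_linearMap _ N.injective_subtype)).apply_symm_apply
    ((δ ∘ₗ N.subtype).codRestrict _ (fun n => mem_range_rTensor_iff.2 fun φ => hN φ n n.2) n))).symm

theorem coe_act_subCoact (δ : V →ₗ[k] V ⊗[k] C) (N : Submodule k V)
    (hN : ∀ φ, ∀ v ∈ N, act δ φ v ∈ N) (φ : Module.Dual k C) (n : N) :
    (act (subCoact δ N hN) φ n : V) = act δ φ n :=
  (comm_coact_iff.1 (subCoact_comm δ N hN) φ n).symm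

/-- The coaction on the quotient by a stable subspace. -/
def quotCoact (δ : V →ₗ[k] V ⊗[k] C) (N : Submodule k V) (hN : ∀ φ, ∀ v ∈ N, act δ φ v ∈ N) :
    (V ⧸ N) →ₗ[k] (V ⧸ N) ⊗[k] C :=
  N.liftQ (N.mkQ.rTensor C ∘ₗ δ) fun v hv => by
    rw [LinearMap.mem_ker]
    refine slice_ext fun φ => ?_
    rw [LinearMap.comp_apply, slice_rTensor, map_zero]
    exact (Submodule.Quotient.mk_eq_zero N).2 (hN φ v hv)

theorem quotCoact_comm (δ : V →ₗ[k] V ⊗[k] C) (N : Submodule k V)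
    (hN : ∀ φ, ∀ v ∈ N, act δ φ v ∈ N) :
    quotCoact δ N hN ∘ₗ N.mkQ = N.mkQ.rTensor C ∘ₗ δ :=
  N.liftQ_mkQ _ _

end Actions

/-! ### Comodules as modules over the convolution algebra. -/

section Coactions

variable {k : Type*} [Field k] {V W C D : Type*} [AddCommGroup V] [Module k V]
  [AddCommGroup W] [Module k W] [AddCommGroup C] [Module k C] [Coalgebra k C]
  [AddCommGroup D] [Module k D] [Coalgebra k D]

/-- A coassociative and counital map `V → V ⊗ C`. -/
structure IsCoaction (δ : V →ₗ[k] V ⊗[k] C) : Prop where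
  coassoc : (TensorProduct.assoc k V C C).toLinearMap ∘ₗ δ.rTensor C ∘ₗ δ =
    (Coalgebra.comul (R := k) (A := C)).lTensor V ∘ₗ δ
  counit : (Coalgebra.counit (R := k) (A := C)).lTensor V ∘ₗ δ =
    (TensorProduct.rid k V).symm.toLinearMap

/-- The convolution product of two functionals on a coalgebra. -/
def conv (φ ψ : Module.Dual k C) : Module.Dual k C :=
  LinearMap.mul' k k ∘ₗ TensorProduct.map φ ψ ∘ₗ Coalgebra.comul

theorem act_conv_eq (δ : V →ₗ[k] V ⊗[k] C) (φ ψ : Module.Dual k C) (v : V) :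
    act δ (conv φ ψ) v = slice V φ (slice (V ⊗[k] C) ψ ((TensorProduct.assoc k V C C).symm
      ((Coalgebra.comul (R := k) (A := C)).lTensor V (δ v)))) := by
  rw [slice_slice_assoc_symm, slice_lTensor]
  rfl

/-- Slicing both sides of the comodule axioms turns them into the axioms of a module over the dual
algebra with unit `counit`, so they can be checked operator by operator. -/
theorem isCoaction_iff {δ : V →ₗ[k] V ⊗[k] C} :
    IsCoaction δ ↔ (∀ φ ψ v, act δ φ (act δ ψ v) = act δ (conv φ ψ) v) ∧
      ∀ v, act δ Coalgebra.counit v = v := by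
  constructor
  · refine fun h => ⟨fun φ ψ v => ?_, fun v => ?_⟩
    · rw [act_act_eq, act_conv_eq]
      have := DFunLike.congr_fun h.coassoc v
      simp only [LinearMap.comp_apply, LinearEquiv.coe_coe] at this
      rw [← this, LinearEquiv.symm_apply_apply]
    · have := DFunLike.congr_fun h.counit v
      simp only [LinearMap.comp_apply, LinearEquiv.coe_coe] at this
      rw [act_apply, slice, LinearMap.comp_apply, this]
      simp
  · rintro ⟨h1, h2⟩
    refine ⟨LinearMap.ext fun v => ?_, LinearMap.ext fun v => ?_⟩
    · simp only [LinearMap.comp_apply, LinearEquiv.coe_coe]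
      rw [← LinearEquiv.eq_symm_apply]
      refine slice_ext fun ψ => slice_ext fun φ => ?_
      rw [← act_act_eq, ← act_conv_eq, h1]
    · exact (LinearEquiv.eq_symm_apply _).2 (h2 v)

namespace IsCoaction

variable {δ : V →ₗ[k] V ⊗[k] C}

theorem act_act (h : IsCoaction δ) (φ ψ : Module.Dual k C) (v : V) :
    act δ φ (act δ ψ v) = act δ (conv φ ψ) v := (isCoaction_iff.1 h).1 φ ψ v

theorem act_counit (h : IsCoaction δ) (v : V) : act δ Coalgebra.counit v = v :=
  (isCoaction_iff.1 h).2 v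

end IsCoaction

theorem isCoaction_comul : IsCoaction (Coalgebra.comul (R := k) (A := C)) :=
  ⟨Coalgebra.coassoc, by ext; simp⟩

theorem conv_comm [Coalgebra.IsCocomm k C] (φ ψ : Module.Dual k C) : conv φ ψ = conv ψ φ := by
  have h : LinearMap.mul' k k ∘ₗ TensorProduct.map φ ψ =
      (LinearMap.mul' k k ∘ₗ TensorProduct.map ψ φ) ∘ₗ (TensorProduct.comm k C C).toLinearMap := by
    ext
    simp [mul_comm]
  ext x
  have := DFunLike.congr_fun h (Coalgebra.comul (R := k) x)
  simp only [LinearMap.comp_apply, LinearEquiv.coe_coe, Coalgebra.comm_comul] at this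
  simpa [conv] using this

theorem IsCoaction.act_comm [Coalgebra.IsCocomm k C] {δ : V →ₗ[k] V ⊗[k] C} (h : IsCoaction δ)
    (φ ψ : Module.Dual k C) (v : V) : act δ φ (act δ ψ v) = act δ ψ (act δ φ v) := by
  rw [h.act_act, h.act_act, conv_comm]

theorem IsCoaction.of_injective {δ : V →ₗ[k] V ⊗[k] C} {η : W →ₗ[k] W ⊗[k] C} {f : V →ₗ[k] W}
    (hf : Function.Injective f) (h : η ∘ₗ f = f.rTensor C ∘ₗ δ) (hη : IsCoaction η) :
    IsCoaction δ := by
  rw [comm_coact_iff] at h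
  refine isCoaction_iff.2 ⟨fun φ ψ v => hf ?_, fun v => hf ?_⟩
  · rw [← h, ← h, ← h, hη.act_act]
  · rw [← h, hη.act_counit]

theorem IsCoaction.of_surjective {δ : V →ₗ[k] V ⊗[k] C} {η : W →ₗ[k] W ⊗[k] C} {f : V →ₗ[k] W}
    (hf : Function.Surjective f) (h : η ∘ₗ f = f.rTensor C ∘ₗ δ) (hδ : IsCoaction δ) :
    IsCoaction η := by
  rw [comm_coact_iff] at h
  refine isCoaction_iff.2 ⟨fun φ ψ w => ?_, fun w => ?_⟩
  · obtain ⟨v, rfl⟩ := hf w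
    rw [h, h, h, hδ.act_act]
  · obtain ⟨v, rfl⟩ := hf w
    rw [h, hδ.act_counit]

theorem conv_comp (θ : C →ₗc[k] D) (φ ψ : Module.Dual k D) :
    conv φ ψ ∘ₗ (θ : C →ₗ[k] D) = conv (φ ∘ₗ (θ : C →ₗ[k] D)) (ψ ∘ₗ (θ : C →ₗ[k] D)) := by
  rw [conv, conv, TensorProduct.map_comp, LinearMap.comp_assoc, LinearMap.comp_assoc,
    LinearMap.comp_assoc]
  congr 2
  exact θ.map_comp_comul.symm

theorem IsCoaction.lTensor {δ : V →ₗ[k] V ⊗[k] C} (h : IsCoaction δ) (θ : C →ₗc[k] D) :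
    IsCoaction ((θ : C →ₗ[k] D).lTensor V ∘ₗ δ) := by
  refine isCoaction_iff.2 ⟨fun φ ψ v => ?_, fun v => ?_⟩
  · rw [act_lTensor, act_lTensor, act_lTensor, conv_comp, h.act_act]
  · rw [act_lTensor]
    have : Coalgebra.counit ∘ₗ (θ : C →ₗ[k] D) = Coalgebra.counit (R := k) := θ.counit_comp
    rw [this, h.act_counit]

/-- A linear retraction of `θ` shows that every functional on `C` is the restriction of one on `D`,
so the module axioms descend. -/
theorem IsCoaction.of_lTensor {δ : V →ₗ[k] V ⊗[k] C} (θ : C →ₗc[k] D)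
    (hθ : Function.Injective θ) (h : IsCoaction ((θ : C →ₗ[k] D).lTensor V ∘ₗ δ)) :
    IsCoaction δ := by
  obtain ⟨r, hr⟩ := (θ : C →ₗ[k] D).exists_leftInverse_of_injective
    (LinearMap.ker_eq_bot.2 hθ)
  have key : ∀ φ : Module.Dual k C, φ = (φ ∘ₗ r) ∘ₗ (θ : C →ₗ[k] D) := fun φ => by
    rw [LinearMap.comp_assoc, hr, LinearMap.comp_id]
  refine isCoaction_iff.2 ⟨fun φ ψ v => ?_, fun v => ?_⟩
  · rw [key φ, key ψ, ← conv_comp, ← act_lTensor (θ : C →ₗ[k] D), ← act_lTensor (θ : C →ₗ[k] D),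
      ← act_lTensor (θ : C →ₗ[k] D), h.act_act]
  · have : Coalgebra.counit ∘ₗ (θ : C →ₗ[k] D) = Coalgebra.counit (R := k) := θ.counit_comp
    rw [← this, ← act_lTensor, h.act_counit]

end Coactions

/-! ### Matrix coefficients. -/

section Coefficients

variable {k : Type*} [Field k] {V C : Type*} [AddCommGroup V] [Module k V]
  [AddCommGroup C] [Module k C]

/-- The matrix coefficients of a comodule. -/
def coeff (δ : V →ₗ[k] V ⊗[k] C) (f : Module.Dual k V) : V →ₗ[k] C := coslice C f ∘ₗ δ

theorem apply_coeff (δ : V →ₗ[k] V ⊗[k] C) (f : Module.Dual k V) (φ : Module.Dual k C) (v : V) :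
    φ (coeff δ f v) = f (act δ φ v) := (apply_slice f φ (δ v)).symm

theorem eq_of_forall_dual {v w : V} (h : ∀ f : Module.Dual k V, f v = f w) : v = w :=
  sub_eq_zero.1 ((Module.forall_dual_apply_eq_zero_iff k _).1 fun f => by rw [map_sub, h, sub_self])

variable [Coalgebra k C]

theorem apply_act_comul (φ ψ : Module.Dual k C) (x : C) :
    ψ (act (Coalgebra.comul (R := k)) φ x) = conv ψ φ x := by
  rw [act_apply, conv, LinearMap.comp_apply, LinearMap.comp_apply]
  induction (Coalgebra.comul (R := k) x) with
  | zero => simp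
  | add x y hx hy => simp only [map_add, hx, hy]
  | tmul v c => simp [mul_comm]

/-- Taking the coefficients against a fixed `f` is a comodule morphism from `V` to the regular
comodule; with `counit_coeff`, these morphisms jointly embed `V` in copies of it. -/
theorem act_comul_coeff {δ : V →ₗ[k] V ⊗[k] C} (h : IsCoaction δ) (f : Module.Dual k V)
    (φ : Module.Dual k C) (v : V) :
    act (Coalgebra.comul (R := k)) φ (coeff δ f v) = coeff δ f (act δ φ v) := by
  refine eq_of_forall_dual (k := k) fun ψ => ?_
  rw [apply_act_comul, apply_coeff, apply_coeff, h.act_act]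

theorem counit_coeff {δ : V →ₗ[k] V ⊗[k] C} (h : IsCoaction δ) (f : Module.Dual k V) (v : V) :
    Coalgebra.counit (R := k) (coeff δ f v) = f v := by
  rw [apply_coeff, h.act_counit]

end Coefficients

/-! ### The filtration by iterated fixed vectors. -/

section Filtration

variable {k : Type*} [Field k] {A : Type*} [CommRing A] [Bialgebra k A]
  {V W : Type*} [AddCommGroup V] [Module k V] [AddCommGroup W] [Module k W]

/-- The ascending filtration of a comodule whose first step consists of the fixed vectors, and
whose steps induce the fixed vectors in the successive quotients. -/
def fil (δ : V →ₗ[k] V ⊗[k] A) : ℕ → Submodule k V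
  | 0 => ⊥
  | n + 1 => ⨅ φ : Module.Dual k A, (fil δ n).comap (act δ φ - φ 1 • LinearMap.id)

variable {δ : V →ₗ[k] V ⊗[k] A} {η : W →ₗ[k] W ⊗[k] A}

theorem mem_fil_zero {v : V} : v ∈ fil δ 0 ↔ v = 0 := Iff.rfl

theorem mem_fil_succ {n : ℕ} {v : V} :
    v ∈ fil δ (n + 1) ↔ ∀ φ : Module.Dual k A, act δ φ v - φ 1 • v ∈ fil δ n := by
  simp [fil, Submodule.mem_iInf]

theorem fil_le_succ (n : ℕ) : fil δ n ≤ fil δ (n + 1) := by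
  induction n with
  | zero => exact bot_le
  | succ n ih => exact fun v hv => mem_fil_succ.2 fun φ => ih (mem_fil_succ.1 hv φ)

theorem fil_mono : Monotone (fil δ) := monotone_nat_of_le_succ fil_le_succ

theorem act_mem_fil {n : ℕ} (φ : Module.Dual k A) {v : V} (hv : v ∈ fil δ n) :
    act δ φ v ∈ fil δ n := by
  cases n with
  | zero => rw [mem_fil_zero.1 hv, map_zero]; exact zero_mem _
  | succ n =>
    rw [← sub_add_cancel (act δ φ v) (φ 1 • v)]
    exact add_mem (fil_le_succ n (mem_fil_succ.1 hv φ)) (Submodule.smul_mem _ _ hv)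

theorem map_mem_fil {f : V →ₗ[k] W} (h : ∀ φ v, act η φ (f v) = f (act δ φ v)) {n : ℕ} {v : V}
    (hv : v ∈ fil δ n) : f v ∈ fil η n := by
  induction n generalizing v with
  | zero => rw [mem_fil_zero.1 hv, map_zero]; exact zero_mem _
  | succ n ih =>
    refine mem_fil_succ.2 fun φ => ?_
    rw [h, ← map_smul, ← map_sub]
    exact ih (mem_fil_succ.1 hv φ)

/-- The coefficient maps are comodule morphisms with no common kernel, so the filtration of any
comodule is pulled back from that of `A`. -/
theorem mem_fil_iff_coeff (hδ : IsCoaction δ) {n : ℕ} {v : V} :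
    v ∈ fil δ n ↔ ∀ f, coeff δ f v ∈ fil (Coalgebra.comul (R := k) (A := A)) n := by
  induction n generalizing v with
  | zero =>
    refine ⟨fun h f => ?_, fun h => mem_fil_zero.2 (eq_of_forall_dual (k := k) fun f => ?_)⟩
    · rw [mem_fil_zero.1 h, map_zero]; exact zero_mem _
    · rw [← counit_coeff hδ, mem_fil_zero.1 (h f), map_zero, map_zero]
  | succ n ih =>
    simp_rw [mem_fil_succ, ih, map_sub, map_smul, act_comul_coeff hδ]
    exact forall_comm

/-- If the filtration of a finite-dimensional comodule is exhaustive, it reaches the whole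
comodule. -/
theorem exists_fil_eq_top [Module.Finite k V] (h : ∀ v, ∃ n, v ∈ fil δ n) :
    ∃ n, fil δ n = ⊤ := by
  obtain ⟨n, hn⟩ := monotone_stabilizes_iff_noetherian.2
    (inferInstance : IsNoetherian k V) ⟨fil δ, fil_mono⟩
  refine ⟨n, eq_top_iff.2 fun v _ => ?_⟩
  obtain ⟨m, hm⟩ := h v
  rcases le_total n m with h | h
  · exact (show fil δ n = fil δ m from hn m h) ▸ hm
  · exact fil_mono h hm

end Filtration

/-! ### The union of the filtration of `A` is a Hopf subalgebra. -/

section Component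

variable {k : Type u} [Field k] {A : Type u} [CommRing A] [HopfAlgebra k A]

theorem one_mem_fil : (1 : A) ∈ fil (Coalgebra.comul (R := k) (A := A)) 1 :=
  mem_fil_succ.2 fun φ => by
    rw [act_apply, Bialgebra.comul_one, Algebra.TensorProduct.one_def, slice_tmul, sub_self]
    exact zero_mem _

theorem slice_mul_mem {P Q N : Submodule k A} (h : ∀ a ∈ P, ∀ b ∈ Q, a * b ∈ N)
    {z w : A ⊗[k] A} (hz : ∀ φ : Module.Dual k A, slice A φ z ∈ P)
    (hw : ∀ φ : Module.Dual k A, slice A φ w ∈ Q) (φ : Module.Dual k A) :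
    slice A φ (z * w) ∈ N := by
  obtain ⟨z, rfl⟩ := mem_range_rTensor_iff.2 hz
  obtain ⟨w, rfl⟩ := mem_range_rTensor_iff.2 hw
  clear hz hw
  induction z with
  | zero => simp
  | add x y hx hy => simp only [map_add, add_mul]; exact add_mem hx hy
  | tmul p a =>
    induction w with
    | zero => simp
    | add x y hx hy => simp only [map_add, mul_add]; exact add_mem hx hy
    | tmul q b =>
      simp only [LinearMap.rTensor_tmul, Algebra.TensorProduct.tmul_mul_tmul, slice_tmul]
      exact N.smul_mem _ (h p p.2 q q.2)

theorem slice_comul_sub_mem {n : ℕ} {a : A}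
    (ha : a ∈ fil (Coalgebra.comul (R := k) (A := A)) (n + 1)) (φ : Module.Dual k A) :
    slice A φ (Coalgebra.comul (R := k) a - a ⊗ₜ[k] 1) ∈
      fil (Coalgebra.comul (R := k) (A := A)) n := by
  rw [map_sub, slice_tmul]
  exact mem_fil_succ.1 ha φ

/-- A Leibniz rule for `Δ(x) - x ⊗ 1` lowers the total degree by one. The bound `m + n` is not
sharp, since constants have degree one, but it suffices for the union. -/
theorem mul_mem_fil {m n : ℕ} {a b : A} (ha : a ∈ fil (Coalgebra.comul (R := k) (A := A)) m)
    (hb : b ∈ fil (Coalgebra.comul (R := k) (A := A)) n) :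
    a * b ∈ fil (Coalgebra.comul (R := k) (A := A)) (m + n) := by
  induction hN : m + n generalizing m n a b with
  | zero =>
    obtain rfl : m = 0 := by omega
    rw [mem_fil_zero.1 ha, zero_mul]
    exact zero_mem _
  | succ N ih =>
    cases m with
    | zero => rw [mem_fil_zero.1 ha, zero_mul]; exact zero_mem _
    | succ m =>
    cases n with
    | zero => rw [mem_fil_zero.1 hb, mul_zero]; exact zero_mem _
    | succ n =>
      refine mem_fil_succ.2 fun φ => ?_
      -- `Δ(ab) - ab ⊗ 1 = (Δa - a ⊗ 1) Δb + (a ⊗ 1)(Δb - b ⊗ 1)`.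
      have e : act (Coalgebra.comul (R := k) (A := A)) φ (a * b) - φ 1 • (a * b) =
          slice A φ ((Coalgebra.comul (R := k) a - a ⊗ₜ[k] 1) * Coalgebra.comul (R := k) b) +
          slice A φ ((a ⊗ₜ[k] 1) * (Coalgebra.comul (R := k) b - b ⊗ₜ[k] 1)) := by
        rw [← map_add, sub_mul, mul_sub, sub_add_sub_cancel, map_sub,
          Algebra.TensorProduct.tmul_mul_tmul, mul_one, slice_tmul, act_apply,
          Bialgebra.comul_mul]
      rw [e]
      have h1 : ∀ φ : Module.Dual k A, slice A φ (a ⊗ₜ[k] 1) ∈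
          fil (Coalgebra.comul (R := k) (A := A)) (m + 1) := fun φ => by
        rw [slice_tmul]
        exact Submodule.smul_mem _ _ ha
      have h2 : ∀ φ : Module.Dual k A, slice A φ (Coalgebra.comul (R := k) b) ∈
          fil (Coalgebra.comul (R := k) (A := A)) (n + 1) := fun φ => act_mem_fil φ hb
      exact add_mem
        (slice_mul_mem (fun a ha b hb => ih ha hb (by omega)) (slice_comul_sub_mem ha) h2 φ)
        (slice_mul_mem (fun a ha b hb => ih ha hb (by omega)) h1 (slice_comul_sub_mem hb) φ)

variable (k A) in
/-- The irreducible component of the unit in the coalgebra `A`. -/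
def componentSubalgebra : Subalgebra k A where
  carrier := {a | ∃ n, a ∈ fil (Coalgebra.comul (R := k) (A := A)) n}
  mul_mem' := fun ⟨m, hm⟩ ⟨n, hn⟩ => ⟨m + n, mul_mem_fil hm hn⟩
  add_mem' := fun ⟨m, hm⟩ ⟨n, hn⟩ => ⟨max m n,
    add_mem (fil_mono (le_max_left m n) hm) (fil_mono (le_max_right m n) hn)⟩
  algebraMap_mem' r := ⟨1, by
    rw [Algebra.algebraMap_eq_smul_one]
    exact Submodule.smul_mem _ _ one_mem_fil⟩

theorem slice_comul_mem_component {a : A} (ha : a ∈ componentSubalgebra k A)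
    (φ : Module.Dual k A) :
    slice A φ (Coalgebra.comul (R := k) a) ∈ componentSubalgebra k A := by
  obtain ⟨n, hn⟩ := ha
  exact ⟨n, act_mem_fil φ hn⟩

variable [Coalgebra.IsCocomm k A]

theorem coslice_comul_mem_component {a : A} (ha : a ∈ componentSubalgebra k A)
    (φ : Module.Dual k A) :
    coslice A φ (Coalgebra.comul (R := k) a) ∈ componentSubalgebra k A := by
  rw [coslice_eq_slice_comm, Coalgebra.comm_comul]
  exact slice_comul_mem_component ha φ

/-- The left factors of `Δa - a ⊗ 1` lie one step lower. Applying antipode and multiplication gives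
`ε(a) - S(a)`, so induction on the step applies; cocommutativity keeps the right factors in the
component. -/
theorem antipode_mem_component {a : A} (ha : a ∈ componentSubalgebra k A) :
    HopfAlgebra.antipode k a ∈ componentSubalgebra k A := by
  obtain ⟨n, hn⟩ := ha
  induction n generalizing a with
  | zero => rw [mem_fil_zero.1 hn, map_zero]; exact zero_mem _
  | succ n ih =>
    obtain ⟨w, hw⟩ := mem_range_map_of_slice_of_coslice
      (Q := Subalgebra.toSubmodule (componentSubalgebra k A)) (slice_comul_sub_mem hn)
      (fun f => by
        rw [map_sub, coslice_tmul]
        exact sub_mem (coslice_comul_mem_component ⟨_, hn⟩ f)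
          (Subalgebra.smul_mem _ (one_mem _) _))
    have h1 : LinearMap.mul' k A ((HopfAlgebra.antipode k (A := A)).rTensor A
        (Coalgebra.comul (R := k) a - a ⊗ₜ[k] 1)) ∈ componentSubalgebra k A := by
      rw [← hw]
      clear hw
      induction w with
      | zero => simp
      | add x y hx hy => simp only [map_add]; exact add_mem hx hy
      | tmul p q => simpa using mul_mem (ih p.2) q.2
    rw [map_sub, map_sub, HopfAlgebra.mul_antipode_rTensor_comul_apply, LinearMap.rTensor_tmul,
      LinearMap.mul'_apply, mul_one] at h1
    simpa using sub_mem (Subalgebra.algebraMap_mem (componentSubalgebra k A)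
      (Coalgebra.counit (R := k) a)) h1

variable (k A) in
/-- The irreducible component of the unit as a Hopf subalgebra. -/
def component : HopfSubalgebra k A where
  toSubalgebra := componentSubalgebra k A
  comul_mem a ha := by
    obtain ⟨w, hw⟩ := mem_range_map_of_slice_of_coslice
      (P := Subalgebra.toSubmodule (componentSubalgebra k A))
      (Q := Subalgebra.toSubmodule (componentSubalgebra k A))
      (slice_comul_mem_component ha) (coslice_comul_mem_component ha)
    exact ⟨w, hw⟩
  antipode_mem _ ha := antipode_mem_component ha

end Component

/-! ### Transfer of the filtration, fixed vectors and local finiteness. -/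

section

variable {k : Type*} [Field k] {A A' : Type*} [CommRing A] [Bialgebra k A]
  [CommRing A'] [Bialgebra k A'] {V : Type*} [AddCommGroup V] [Module k V]

theorem fil_le_fil_lTensor (δ : V →ₗ[k] V ⊗[k] A) (θ : A →ₗ[k] A') (hθ : θ 1 = 1) (n : ℕ) :
    fil δ n ≤ fil (θ.lTensor V ∘ₗ δ) n := by
  induction n with
  | zero => exact le_rfl
  | succ n ih =>
    refine fun v hv => mem_fil_succ.2 fun φ => ih ?_
    have := mem_fil_succ.1 hv (φ ∘ₗ θ)
    rwa [LinearMap.comp_apply, hθ, ← act_lTensor] at this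

theorem exists_coact_eq_tmul_one [Nontrivial V] {δ : V →ₗ[k] V ⊗[k] A} {n : ℕ}
    (h : fil δ n = ⊤) : ∃ v : V, v ≠ 0 ∧ δ v = v ⊗ₜ[k] (1 : A) := by
  classical
  -- The first nonzero step of the filtration consists of fixed vectors, as the step below it is
  -- zero.
  have hex : ∃ n, fil δ n ≠ ⊥ := ⟨n, h ▸ top_ne_bot⟩
  obtain ⟨m, hm⟩ : ∃ m, Nat.find hex = m + 1 :=
    Nat.exists_eq_succ_of_ne_zero fun h0 => Nat.find_spec hex (by rw [h0]; rfl)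
  have h1 : fil δ m = ⊥ := not_not.1 (Nat.find_min hex (by omega))
  have h2 : fil δ (m + 1) ≠ ⊥ := hm ▸ Nat.find_spec hex
  obtain ⟨v, hv, hv0⟩ := Submodule.exists_mem_ne_zero_of_ne_bot h2
  refine ⟨v, hv0, slice_ext fun φ => ?_⟩
  have := mem_fil_succ.1 hv φ
  rw [h1, Submodule.mem_bot, sub_eq_zero] at this
  rw [slice_tmul]
  exact this

theorem exists_finite_slice_mem {C : Type*} [AddCommGroup C] [Module k C] (z : V ⊗[k] C) :
    ∃ N : Submodule k V, Module.Finite k N ∧ ∀ φ, slice V φ z ∈ N := by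
  induction z with
  | zero => exact ⟨⊥, inferInstance, fun φ => by simp⟩
  | add x y hx hy =>
    obtain ⟨N, hN, hx⟩ := hx
    obtain ⟨P, hP, hy⟩ := hy
    refine ⟨N ⊔ P, inferInstance, fun φ => ?_⟩
    rw [map_add]
    exact Submodule.add_mem_sup (hx φ) (hy φ)
  | tmul v c =>
    refine ⟨k ∙ v, inferInstance, fun φ => ?_⟩
    rw [slice_tmul]
    exact Submodule.smul_mem _ _ (Submodule.mem_span_singleton_self v)

end

/-! ### The largest unipotent quotient is given by the component of the unit. -/

section

variable {k : Type u} [Field k] {A : Type u} [CommRing A] [HopfAlgebra k A]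

theorem FinRep.isCoaction (V : FinRep k A) : IsCoaction V.coact := ⟨V.coassoc, V.counit⟩

/-- The `H`-module given by a coaction on a finite-dimensional space. -/
abbrev FinRep.ofCoaction {V : Type u} [AddCommGroup V] [Module k V] [Module.Finite k V]
    {δ : V →ₗ[k] V ⊗[k] A} (h : IsCoaction δ) : FinRep k A where
  carrier := V
  coact := δ
  coassoc := h.coassoc
  counit := h.counit

theorem FinRep.act_lin {V W : FinRep k A} (f : V ⟶ W) (φ : Module.Dual k A) (v : V.carrier) :
    act W.coact φ (FinRep.lin f v) = FinRep.lin f (act V.coact φ v) :=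
  comm_coact_iff.1 (FinRep.lin_comm f) φ v

/-- A linear map commuting with the actions of functionals, as a morphism of `H`-modules. -/
def FinRep.ofAct {V W : FinRep k A} (f : V.carrier →ₗ[k] W.carrier)
    (hf : ∀ φ v, act W.coact φ (f v) = f (act V.coact φ v)) : V ⟶ W :=
  FinRep.ofLin f (comm_coact_iff.2 hf)

theorem FinRep.lin_ofAct {V W : FinRep k A} (f : V.carrier →ₗ[k] W.carrier)
    (hf : ∀ φ v, act W.coact φ (f v) = f (act V.coact φ v)) :
    FinRep.lin (FinRep.ofAct f hf) = f := rfl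

theorem FinRep.lin_comp {V W X : FinRep k A} (f : V ⟶ W) (g : W ⟶ X) :
    FinRep.lin (f ≫ g) = FinRep.lin g ∘ₗ FinRep.lin f := rfl

theorem FinRep.lin_id (V : FinRep k A) : FinRep.lin (𝟙 V) = LinearMap.id := rfl

/-- A bijective linear map commuting with the actions of functionals, as an isomorphism of
`H`-modules. -/
def FinRep.isoOfAct {V W : FinRep k A} (f : V.carrier ≃ₗ[k] W.carrier)
    (hf : ∀ φ v, act W.coact φ (f v) = f (act V.coact φ v)) : V ≅ W where
  hom := FinRep.ofAct f.toLinearMap hf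
  inv := FinRep.ofAct f.symm.toLinearMap fun φ w => f.injective <| by
    simp only [LinearEquiv.coe_coe]
    rw [← hf, f.apply_symm_apply, f.apply_symm_apply]
  hom_inv_id := FinRep.lin_injective _ _ (by
    ext; simp [FinRep.lin_comp, FinRep.lin_ofAct, FinRep.lin_id])
  inv_hom_id := FinRep.lin_injective _ _ (by
    ext; simp [FinRep.lin_comp, FinRep.lin_ofAct, FinRep.lin_id])

/-- A stable subspace as an `H`-module. -/
abbrev FinRep.sub (V : FinRep k A) (N : Submodule k V.carrier)
    (hN : ∀ φ, ∀ v ∈ N, act V.coact φ v ∈ N) : FinRep k A :=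
  FinRep.ofCoaction (IsCoaction.of_injective N.injective_subtype (subCoact_comm V.coact N hN)
    V.isCoaction)

/-- The quotient by a stable subspace as an `H`-module. -/
abbrev FinRep.quot (V : FinRep k A) (N : Submodule k V.carrier)
    (hN : ∀ φ, ∀ v ∈ N, act V.coact φ v ∈ N) : FinRep k A :=
  FinRep.ofCoaction (IsCoaction.of_surjective N.mkQ_surjective (quotCoact_comm V.coact N hN)
    V.isCoaction)

theorem FinRep.isSubmodule_iff {V : FinRep k A} {N : Submodule k V.carrier} :
    V.IsSubmodule N ↔ ∀ φ, ∀ v ∈ N, act V.coact φ v ∈ N :=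
  ⟨fun h φ v hv => mem_range_rTensor_iff.1 (h v hv) φ,
    fun h v hv => mem_range_rTensor_iff.2 fun φ => h φ v hv⟩

/-- If every nonzero quotient of an `H`-module contains a nonzero fixed vector, its filtration by
fixed vectors is exhaustive. -/
theorem FinRep.exists_fil_eq_top_of_fixed (V : FinRep k A)
    (h : ∀ (N : Submodule k V.carrier) (hN : ∀ φ, ∀ v ∈ N, act V.coact φ v ∈ N), N ≠ ⊤ →
      ∃ x : V.carrier ⧸ N, x ≠ 0 ∧ ∀ φ, act (quotCoact V.coact N hN) φ x = φ 1 • x) :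
    ∃ n, fil V.coact n = ⊤ := by
  obtain ⟨n, hn⟩ := monotone_stabilizes_iff_noetherian.2
    (inferInstance : IsNoetherian k V.carrier) ⟨fil V.coact, fil_mono⟩
  -- Once the filtration is stationary, a vector fixed modulo `fil n` lies in `fil (n + 1) = fil n`,
  -- so the quotient has no nonzero fixed vector.
  have hn : fil V.coact n = fil V.coact (n + 1) := hn (n + 1) n.le_succ
  refine ⟨n, by_contra fun hne => ?_⟩
  obtain ⟨x, hx0, hx⟩ := h (fil V.coact n) (fun φ v hv => act_mem_fil φ hv) hne
  obtain ⟨v, rfl⟩ := (fil V.coact n).mkQ_surjective x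
  refine hx0 ((Submodule.Quotient.mk_eq_zero _).2 ?_)
  rw [hn]
  refine mem_fil_succ.2 fun φ => ?_
  have h1 := hx φ
  rw [comm_coact_iff.1 (quotCoact_comm V.coact (fil V.coact n)
    fun φ v hv => act_mem_fil φ hv) φ v, ← map_smul, ← sub_eq_zero, ← map_sub] at h1
  exact (Submodule.Quotient.mk_eq_zero _).1 h1

theorem IsUnipotent.exists_fil_eq_top (h : IsUnipotent k A) (V : FinRep k A) :
    ∃ n, fil V.coact n = ⊤ := by
  refine FinRep.exists_fil_eq_top_of_fixed V fun N hN hne => ?_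
  obtain ⟨x, hx0, hx⟩ := h (V.quot N hN) (Submodule.Quotient.nontrivial_iff.2 hne)
  refine ⟨x, hx0, fun φ => ?_⟩
  exact (congrArg (slice _ φ) hx).trans (slice_tmul φ x 1)

namespace HopfSubalgebra

variable (S : HopfSubalgebra k A)

/-- The inclusion of a Hopf subalgebra as a homomorphism of coalgebras. -/
def valCoalgHom : S.Carrier →ₗc[k] A where
  toLinearMap := S.val.toLinearMap
  counit_comp := rfl
  map_comp_comul := LinearMap.ext fun a => S.map_comulHom a

theorem valCoalgHom_injective : Function.Injective S.valCoalgHom := Subtype.val_injective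

end HopfSubalgebra

/-- The element generates a finite-dimensional subcomodule of the regular comodule of `S`.
Unipotence makes its filtration exhaustive, and the inclusions into `S` and then `A` respect
filtrations. -/
theorem mem_component_of_isUnipotent {S : HopfSubalgebra k A} (hS : IsUnipotent k S.Carrier)
    {a : A} (ha : a ∈ S.toSubalgebra) : a ∈ componentSubalgebra k A := by
  let Δ := Coalgebra.comul (R := k) (A := S.Carrier)
  let x : S.Carrier := ⟨a, ha⟩
  let N : Submodule k S.Carrier := Submodule.span k (Set.range fun φ => act Δ φ x)
  have hx : x ∈ N := Submodule.subset_span ⟨Coalgebra.counit, isCoaction_comul.act_counit x⟩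
  have hN : ∀ φ, ∀ v ∈ N, act Δ φ v ∈ N := by
    intro φ v hv
    induction hv using Submodule.span_induction with
    | mem v hv =>
      obtain ⟨ψ, rfl⟩ := hv
      exact Submodule.subset_span ⟨conv φ ψ, (isCoaction_comul.act_act φ ψ x).symm⟩
    | zero => rw [map_zero]; exact zero_mem _
    | add v w _ _ hv hw => rw [map_add]; exact add_mem hv hw
    | smul c v _ hv => rw [map_smul]; exact N.smul_mem c hv
  have hfin : Module.Finite k N := by
    obtain ⟨P, hP, h⟩ := exists_finite_slice_mem (Δ x)
    refine Submodule.finiteDimensional_of_le (S₂ := P) (Submodule.span_le.2 ?_)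
    rintro _ ⟨φ, rfl⟩
    exact h φ
  obtain ⟨n, hn⟩ := hS.exists_fil_eq_top (FinRep.ofCoaction
    (IsCoaction.of_injective N.injective_subtype (subCoact_comm Δ N hN) isCoaction_comul))
  refine ⟨n, ?_⟩
  have h1 : (⟨x, hx⟩ : N) ∈ fil (subCoact Δ N hN) n := by
    have : (⟨x, hx⟩ : N) ∈ (⊤ : Submodule k N) := trivial
    rwa [← hn] at this
  have h2 : x ∈ fil Δ n := map_mem_fil (f := N.subtype)
    (comm_coact_iff.1 (subCoact_comm Δ N hN)) h1
  have h3 := fil_le_fil_lTensor Δ S.valCoalgHom.toLinearMap rfl n h2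
  refine map_mem_fil (f := S.valCoalgHom.toLinearMap) (comm_coact_iff.1 ?_) h3
  rw [← LinearMap.comp_assoc, LinearMap.rTensor_comp_lTensor]
  exact S.valCoalgHom.map_comp_comul.symm

/-- The hypothesis places `δ v` in `V ⊗ componentSubalgebra`. As a finite sum of pure tensors it has
all its coefficients in a single step, uniformly in `f`. -/
theorem exists_fil_eq_top_of_coeff_mem {V : Type*} [AddCommGroup V] [Module k V]
    [Module.Finite k V] {δ : V →ₗ[k] V ⊗[k] A} (hδ : IsCoaction δ)
    (h : ∀ f v, coeff δ f v ∈ componentSubalgebra k A) : ∃ n, fil δ n = ⊤ := by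
  refine exists_fil_eq_top fun v => ?_
  simp_rw [mem_fil_iff_coeff hδ]
  obtain ⟨w, hw⟩ := mem_range_lTensor_iff
    (N := Subalgebra.toSubmodule (componentSubalgebra k A)) (z := δ v) |>.2 fun f => h f v
  simp only [coeff, LinearMap.comp_apply]
  rw [← hw]
  clear hw
  induction w with
  | zero => exact ⟨0, fun f => by simp⟩
  | add x y hx hy =>
    obtain ⟨m, hm⟩ := hx
    obtain ⟨n, hn⟩ := hy
    refine ⟨max m n, fun f => ?_⟩
    rw [map_add, map_add]
    exact add_mem (fil_mono (le_max_left m n) (hm f)) (fil_mono (le_max_right m n) (hn f))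
  | tmul v c =>
    obtain ⟨n, hn⟩ := c.2
    refine ⟨n, fun f => ?_⟩
    rw [LinearMap.lTensor_tmul, coslice_tmul]
    exact Submodule.smul_mem _ _ hn

theorem coeff_lTensor_val_mem {V : Type*} [AddCommGroup V] [Module k V] (S : HopfSubalgebra k A)
    (δ : V →ₗ[k] V ⊗[k] S.Carrier) (f : Module.Dual k V) (v : V) :
    coeff ((S.valCoalgHom : S.Carrier →ₗ[k] A).lTensor V ∘ₗ δ) f v ∈ S.toSubalgebra := by
  rw [coeff, LinearMap.comp_apply, LinearMap.comp_apply, coslice_lTensor]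
  exact (coslice S.Carrier f (δ v)).2

variable [Coalgebra.IsCocomm k A]

variable (k A) in
-- A module over the component has coefficients in it, so its filtration over `A` is exhaustive and
-- yields a fixed vector; injectivity of `V ⊗ S → V ⊗ A` brings the fixedness back.
theorem isUnipotent_component : IsUnipotent k (component k A).Carrier := by
  intro V hV
  let ι := (component k A).valCoalgHom
  obtain ⟨n, hn⟩ := exists_fil_eq_top_of_coeff_mem (V.isCoaction.lTensor ι)
    (coeff_lTensor_val_mem (component k A) V.coact)
  obtain ⟨v, hv0, hv⟩ := exists_coact_eq_tmul_one hn
  refine ⟨v, hv0, Module.Flat.lTensor_preserves_injective_linearMap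
    (ι : (component k A).Carrier →ₗ[k] A) (component k A).valCoalgHom_injective ?_⟩
  exact hv

/-- The largest unipotent quotient of `H` is given by the irreducible component of the unit. -/
theorem unipotentQuotient_toSubalgebra :
    (unipotentQuotient k A).toSubalgebra = componentSubalgebra k A :=
  le_antisymm (iSup_le fun S _ ha => mem_component_of_isUnipotent S.2 ha)
    (le_iSup (fun S : {S : HopfSubalgebra k A // IsUnipotent k S.Carrier} => S.1.toSubalgebra)
      ⟨component k A, isUnipotent_component k A⟩)

end

/-! ### Comodules over `K ⊗ A` as `A`-comodules with a `K`-structure. -/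

section BaseChange

variable {k K : Type*} [Field k] [Field K] [Algebra k K] {A : Type*} [AddCommGroup A] [Module k A]
  {M : Type*} [AddCommGroup M] [Module k M] [Module K M] [IsScalarTower k K M]

theorem slice_smul (φ : Module.Dual k A) (c : K) (z : M ⊗[k] A) :
    slice M φ (c • z) = c • slice M φ z := by
  induction z with
  | zero => simp
  | add x y hx hy => simp only [smul_add, map_add, hx, hy]
  | tmul v a => rw [TensorProduct.smul_tmul', slice_tmul, slice_tmul, smul_comm]

theorem act_smul (δ : M →ₗ[K] M ⊗[k] A) (φ : Module.Dual k A) (c : K) (m : M) :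
    act (δ.restrictScalars k) φ (c • m) = c • act (δ.restrictScalars k) φ m := by
  rw [act_apply, LinearMap.restrictScalars_apply, map_smul, slice_smul]
  rfl

variable (k K A M) in
/-- The isomorphism of `M ⊗[K] (K ⊗[k] A)` with `M ⊗[k] A`. -/
abbrev cancel : M ⊗[K] (K ⊗[k] A) ≃ₗ[K] M ⊗[k] A :=
  TensorProduct.AlgebraTensorModule.cancelBaseChange k K K M A

variable (k K A M) in
/-- The isomorphism of `M ⊗[K] ((K ⊗[k] A) ⊗[K] (K ⊗[k] A))` with `M ⊗[k] (A ⊗[k] A)`. -/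
def cancelTwo : M ⊗[K] ((K ⊗[k] A) ⊗[K] (K ⊗[k] A)) ≃ₗ[K] M ⊗[k] (A ⊗[k] A) :=
  (TensorProduct.AlgebraTensorModule.distribBaseChange k K A A).symm.lTensor M ≪≫ₗ
    cancel k K (A ⊗[k] A) M

theorem cancelTwo_tmul (m : M) (c d : K) (a b : A) :
    cancelTwo k K A M (m ⊗ₜ ((c ⊗ₜ a) ⊗ₜ (d ⊗ₜ b))) = (c * d) • (m ⊗ₜ (a ⊗ₜ b)) := by
  simp [cancelTwo, TensorProduct.smul_tmul']

theorem cancelTwo_assoc (δ : M →ₗ[K] M ⊗[K] (K ⊗[k] A)) (z : M ⊗[K] (K ⊗[k] A)) :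
    cancelTwo k K A M (TensorProduct.assoc K M (K ⊗[k] A) (K ⊗[k] A) (δ.rTensor _ z)) =
      TensorProduct.assoc k M A A
        ((((cancel k K A M).toLinearMap ∘ₗ δ).restrictScalars k).rTensor A
          (cancel k K A M z)) := by
  induction z with
  | zero => simp
  | add x y hx hy => simp only [map_add, hx, hy]
  | tmul m y =>
    induction y with
    | zero => simp
    | add x y hx hy => simp only [TensorProduct.tmul_add, map_add, hx, hy]
    | tmul c a =>
      rw [LinearMap.rTensor_tmul, cancel,
        TensorProduct.AlgebraTensorModule.cancelBaseChange_tmul, LinearMap.rTensor_tmul,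
        LinearMap.restrictScalars_apply, LinearMap.comp_apply, map_smul]
      induction (δ m) with
      | zero => simp
      | add x y hx hy => simp only [TensorProduct.add_tmul, smul_add, map_add, hx, hy]
      | tmul m' y =>
        induction y with
        | zero => simp
        | add x y hx hy =>
          simp only [TensorProduct.add_tmul, TensorProduct.tmul_add, smul_add, map_add, hx, hy]
        | tmul c' a' =>
          simp [cancelTwo_tmul, TensorProduct.smul_tmul', smul_smul, mul_comm]

variable [Coalgebra k A]

theorem cancel_counit (z : M ⊗[K] (K ⊗[k] A)) :
    TensorProduct.rid K M ((Coalgebra.counit (R := K) (A := K ⊗[k] A)).lTensor M z) =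
      TensorProduct.rid k M ((Coalgebra.counit (R := k) (A := A)).lTensor M (cancel k K A M z)) := by
  induction z with
  | zero => simp
  | add x y hx hy => simp only [map_add, hx, hy]
  | tmul m y =>
    induction y with
    | zero => simp
    | add x y hx hy => simp only [TensorProduct.tmul_add, map_add, hx, hy]
    | tmul c a =>
      rw [LinearMap.lTensor_tmul, TensorProduct.counit_tmul, TensorProduct.rid_tmul]
      simp

theorem cancelTwo_comul (z : M ⊗[K] (K ⊗[k] A)) :
    cancelTwo k K A M ((Coalgebra.comul (R := K) (A := K ⊗[k] A)).lTensor M z) =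
      (Coalgebra.comul (R := k) (A := A)).lTensor M (cancel k K A M z) := by
  induction z with
  | zero => simp
  | add x y hx hy => simp only [map_add, hx, hy]
  | tmul m y =>
    induction y with
    | zero => simp
    | add x y hx hy => simp only [TensorProduct.tmul_add, map_add, hx, hy]
    | tmul c a =>
      rw [LinearMap.lTensor_tmul, TensorProduct.comul_tmul, cancel,
        TensorProduct.AlgebraTensorModule.cancelBaseChange_tmul, LinearMap.lTensor_tmul]
      induction (Coalgebra.comul (R := k) a) with
      | zero => simp
      | add x y hx hy => simp only [TensorProduct.tmul_add, map_add, hx, hy]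
      | tmul a b => simp [cancelTwo_tmul, TensorProduct.smul_tmul']

/-- Comodules over a base change `K ⊗[k] A` are comodules over `A` with a compatible structure of
`K`-module. -/
theorem isCoaction_cancel_iff {δ : M →ₗ[K] M ⊗[K] (K ⊗[k] A)} :
    IsCoaction (((cancel k K A M).toLinearMap ∘ₗ δ).restrictScalars k) ↔ IsCoaction δ := by
  constructor
  · intro h
    refine ⟨LinearMap.ext fun m => (cancelTwo k K A M).injective ?_,
      LinearMap.ext fun m => (TensorProduct.rid K M).injective ?_⟩
    · refine (cancelTwo_assoc δ (δ m)).trans (Eq.trans ?_ (cancelTwo_comul (δ m)).symm)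
      exact DFunLike.congr_fun h.coassoc m
    · refine (cancel_counit (δ m)).trans (Eq.trans ?_
        ((TensorProduct.rid K M).apply_symm_apply m).symm)
      exact (congrArg (TensorProduct.rid k M) (DFunLike.congr_fun h.counit m)).trans
        ((TensorProduct.rid k M).apply_symm_apply m)
  · intro h
    refine ⟨LinearMap.ext fun m => ?_,
      LinearMap.ext fun m => (TensorProduct.rid k M).injective ?_⟩
    · refine (cancelTwo_assoc δ (δ m)).symm.trans (Eq.trans ?_ (cancelTwo_comul (δ m)))
      exact congrArg _ (DFunLike.congr_fun h.coassoc m)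
    · refine (cancel_counit (δ m)).symm.trans (Eq.trans ?_
        ((TensorProduct.rid k M).apply_symm_apply m).symm)
      exact (congrArg (TensorProduct.rid K M) (DFunLike.congr_fun h.counit m)).trans
        ((TensorProduct.rid K M).apply_symm_apply m)

end BaseChange

/-! ### Twisting a coaction by a group-like element. -/

section Twist

/-- Multiplication by a group-like element as a homomorphism of coalgebras. -/
def mulCoalgHom {R D : Type*} [CommRing R] [CommRing D] [Bialgebra R D] {g : D}
    (hg : IsGroupLikeElem R g) : D →ₗc[R] D where
  toLinearMap := LinearMap.mulLeft R g
  counit_comp := by ext x; simp [hg.counit_eq_one]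
  map_comp_comul := by
    ext x
    simp only [LinearMap.comp_apply, LinearMap.mulLeft_apply, Bialgebra.comul_mul,
      hg.comul_eq_tmul_self]
    induction (Coalgebra.comul (R := R) x) with
    | zero => simp
    | add x y hx hy => simp only [map_add, mul_add, hx, hy]
    | tmul a b => simp

variable {k K : Type*} [Field k] [Field K] [Algebra k K] {A : Type*} [CommRing A]
  [HopfAlgebra k A]
  {M : Type*} [AddCommGroup M] [Module k M] [Module K M] [IsScalarTower k K M]

variable (M) in
/-- The action of `K ⊗[k] A` on `M ⊗[k] A`, for a `K`-module `M`. -/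
def tw (g : K ⊗[k] A) : M ⊗[k] A →ₗ[K] M ⊗[k] A :=
  (cancel k K A M).toLinearMap ∘ₗ (LinearMap.mulLeft K g).lTensor M ∘ₗ
    (cancel k K A M).symm.toLinearMap

theorem tw_tmul_tmul (c : K) (a b : A) (m : M) :
    tw M (c ⊗ₜ[k] a) (m ⊗ₜ[k] b) = (c • m) ⊗ₜ[k] (a * b) := by
  simp [tw]

theorem tw_zero : tw M (0 : K ⊗[k] A) = 0 := by
  simp [tw]

theorem tw_add (g h : K ⊗[k] A) : tw M (g + h) = tw M g + tw M h := by
  ext z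
  simp [tw, add_mul, TensorProduct.tmul_add]

theorem tw_one : tw M (1 : K ⊗[k] A) = LinearMap.id := by
  ext z
  simp [tw]

theorem tw_mul (g h : K ⊗[k] A) : tw M (g * h) = tw M g ∘ₗ tw M h := by
  ext z
  simp [tw, LinearMap.mulLeft_mul, LinearMap.lTensor_comp]

theorem slice_tw_tmul (φ : Module.Dual k A) (c : K) (a : A) (z : M ⊗[k] A) :
    slice M φ (tw M (c ⊗ₜ a) z) = c • slice M (φ ∘ₗ LinearMap.mulLeft k a) z := by
  induction z with
  | zero => simp
  | add x y hx hy => simp only [map_add, smul_add, hx, hy]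
  | tmul m b =>
    rw [tw_tmul_tmul, slice_tmul, slice_tmul, LinearMap.comp_apply, LinearMap.mulLeft_apply,
      smul_comm]

theorem slice_tw_tmul_one (φ : Module.Dual k A) (g : K ⊗[k] A) (m : M) :
    slice M φ (tw M g (m ⊗ₜ 1)) = slice K φ g • m := by
  induction g with
  | zero => simp [tw_zero]
  | add x y hx hy => simp only [tw_add, LinearMap.add_apply, map_add, add_smul, hx, hy]
  | tmul c a => rw [tw_tmul_tmul, slice_tmul, slice_tmul, mul_one, smul_assoc]

theorem slice_tw_mem (N : Submodule k M) (hN : ∀ (c : K), ∀ m ∈ N, c • m ∈ N) (g : K ⊗[k] A)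
    {z : M ⊗[k] A} (hz : ∀ φ, slice M φ z ∈ N) (φ : Module.Dual k A) :
    slice M φ (tw M g z) ∈ N := by
  induction g with
  | zero => simp [tw_zero]
  | add x y hx hy => rw [tw_add, LinearMap.add_apply, map_add]; exact add_mem hx hy
  | tmul c a => rw [slice_tw_tmul]; exact hN c _ (hz _)

/-- Over `K ⊗ A`, the twist is composition with multiplication by `g`, which is a coalgebra
endomorphism. -/
theorem tw_isCoaction {g : K ⊗[k] A} (hg : IsGroupLikeElem K g) {δ : M →ₗ[K] M ⊗[k] A}
    (h : IsCoaction (δ.restrictScalars k)) :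
    IsCoaction ((tw M g ∘ₗ δ).restrictScalars k) := by
  have h1 : IsCoaction ((cancel k K A M).symm.toLinearMap ∘ₗ δ) := by
    rw [← isCoaction_cancel_iff, ← LinearMap.comp_assoc, LinearEquiv.comp_symm,
      LinearMap.id_comp]
    exact h
  exact isCoaction_cancel_iff.2 (h1.lTensor (mulCoalgHom hg))

theorem smul_mem_fil {δ : M →ₗ[K] M ⊗[k] A} {n : ℕ} (c : K) {m : M}
    (hm : m ∈ fil (δ.restrictScalars k) n) : c • m ∈ fil (δ.restrictScalars k) n :=
  map_mem_fil (f := (LinearMap.lsmul K M c).restrictScalars k)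
    (fun φ v => act_smul δ φ c v) hm

/-- On a fixed vector the twisted action of `φ` is the scalar `g(φ)`; hence the same holds on every
graded piece of the untwisted filtration. -/
theorem act_tw_sub_mem_fil (g : K ⊗[k] A) {δ : M →ₗ[K] M ⊗[k] A} {n : ℕ} {m : M}
    (hm : m ∈ fil (δ.restrictScalars k) (n + 1)) (φ : Module.Dual k A) :
    act ((tw M g ∘ₗ δ).restrictScalars k) φ m - slice K φ g • m ∈
      fil (δ.restrictScalars k) n := by
  have h : act ((tw M g ∘ₗ δ).restrictScalars k) φ m - slice K φ g • m =
      slice M φ (tw M g (δ m - m ⊗ₜ 1)) := by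
    rw [map_sub, map_sub, slice_tw_tmul_one]
    rfl
  rw [h]
  refine slice_tw_mem _ (fun c m hm => smul_mem_fil c hm) g (fun ψ => ?_) φ
  rw [map_sub, slice_tmul]
  exact mem_fil_succ.1 hm ψ

end Twist

/-! ### Linearity over a separable extension from nilpotent perturbations. -/

section Separable

open Polynomial

variable {k K : Type*} [Field k] [Field K] [Algebra k K]
  {M M' : Type*} [AddCommGroup M] [Module k M]
  [AddCommGroup M'] [Module k M'] [Module K M'] [IsScalarTower k K M']

/-- Precomposition with an endomorphism. -/
def precomp (K : Type*) [Field K] {M : Type*} (M' : Type*) [AddCommGroup M] [Module k M]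
    [AddCommGroup M'] [Module k M'] [Module K M'] [SMulCommClass k K M'] (u : M →ₗ[k] M) :
    Module.End K (M →ₗ[k] M') where
  toFun h := h ∘ₗ u
  map_add' _ _ := rfl
  map_smul' _ _ := rfl

theorem precomp_pow (u : M →ₗ[k] M) (n : ℕ) :
    precomp K M' u ^ n = precomp K M' (u ^ n : Module.End k M) := by
  induction n with
  | zero => rfl
  | succ n ih => rw [pow_succ, ih, pow_succ']; rfl

variable (M) in
/-- Postcomposition with an endomorphism. -/
def postcomp (u : Module.End K M') : Module.End K (M →ₗ[k] M') where
  toFun h := u.restrictScalars k ∘ₗ h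
  map_add' _ _ := LinearMap.ext fun _ => map_add u _ _
  map_smul' _ _ := LinearMap.ext fun _ => map_smul u _ _

theorem postcomp_pow (u : Module.End K M') (n : ℕ) :
    postcomp (k := k) M u ^ n = postcomp M (u ^ n) := by
  induction n with
  | zero => rfl
  | succ n ih => rw [pow_succ', ih, pow_succ']; rfl

variable [Module K M] [IsScalarTower k K M]

theorem aeval_precomp_smul (x : K) (p : k[X]) (h : M →ₗ[k] M') (m : M) :
    aeval (precomp K M' ((LinearMap.lsmul K M x).restrictScalars k))
      (p.map (algebraMap k K)) h m = h (aeval x p • m) := by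
  induction p using Polynomial.induction_on' with
  | add p q hp hq => simp only [Polynomial.map_add, map_add, LinearMap.add_apply, add_smul, hp, hq]
  | monomial n c =>
    have hpow : ((LinearMap.lsmul K M x).restrictScalars k : Module.End k M) ^ n =
        (LinearMap.lsmul K M (x ^ n)).restrictScalars k := by
      induction n with
      | zero => ext; simp
      | succ n ih => rw [pow_succ', ih]; ext m; simpa [pow_succ', mul_smul] using smul_comm _ _ _
    rw [Polynomial.map_monomial, aeval_monomial, aeval_monomial, precomp_pow, hpow,
      ← Algebra.smul_def (A := K), smul_assoc, map_smul, ← algebraMap_smul K c (h _)]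
    rfl

/-- A `k`-linear map that commutes with operators of the form "separable scalar plus nilpotent"
commutes with the scalar. -/
theorem map_smul_of_isNilpotent_sub {x : K} (hx : IsSeparable k x) {a : Module.End K M}
    {a' : Module.End K M'} (ha : IsNilpotent (a - x • 1)) (ha' : IsNilpotent (a' - x • 1))
    {f : M →ₗ[k] M'} (hf : ∀ m, f (a m) = a' (f m)) (m : M) : f (x • m) = x • f m := by
  -- `T` measures the failure of `K`-linearity: `(T h)(m) = h(xm) - x h(m)`. The relation `f a = a'
  -- f` gives `T f = (N₂ - N₁) f` with commuting nilpotent `N₁`, `N₂`, so a power of `T` kills `f`.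
  -- The minimal polynomial of `x` also annihilates `X`, and by separability `x` is a simple root of
  -- it.
  set X := precomp K M' ((LinearMap.lsmul K M x).restrictScalars k) with hX
  set T : Module.End K (M →ₗ[k] M') := X - x • 1 with hT
  set N₁ := precomp K M' ((a - x • 1).restrictScalars k) with hN₁
  set N₂ := postcomp (k := k) M (a' - x • 1) with hN₂
  have h1 : IsNilpotent N₁ := by
    obtain ⟨n, hn⟩ := ha
    refine ⟨n, ?_⟩
    have e : ((a - x • 1).restrictScalars k : Module.End k M) ^ n =
        ((a - x • 1) ^ n).restrictScalars k := by
      clear hn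
      induction n with
      | zero => rfl
      | succ n ih => rw [pow_succ', ih, pow_succ']; rfl
    rw [hN₁, precomp_pow, e, hn]
    ext h m
    exact map_zero h
  have h2 : IsNilpotent N₂ := by
    obtain ⟨n, hn⟩ := ha'
    exact ⟨n, by rw [hN₂, postcomp_pow, hn]; rfl⟩
  have h12 : Commute N₂ N₁ := rfl
  obtain ⟨j, hj⟩ := h12.isNilpotent_sub h2 h1
  have hTN : Commute T (N₂ - N₁) := by
    have e1 : Commute X N₂ := rfl
    have e2 : Commute X N₁ := by
      ext h m
      exact congrArg h (by simp [map_smul] : (a - x • 1) (x • m) = x • (a - x • 1) m)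
    exact (e1.sub_right e2).sub_left ((Commute.one_left _).smul_left x)
  have hTf : T f = (N₂ - N₁) f := by
    ext m
    change f (x • m) - x • f m = (a' (f m) - x • f m) - f (a m - x • m)
    rw [map_sub, hf]
    abel
  have hTj : ∀ i, (T ^ i) f = ((N₂ - N₁) ^ i) f := by
    intro i
    induction i with
    | zero => rfl
    | succ i ih =>
      rw [pow_succ, Module.End.mul_apply, hTf, ← Module.End.mul_apply, (hTN.pow_left i).eq,
        Module.End.mul_apply, ih, ← Module.End.mul_apply, ← pow_succ']
  have hTj0 : (T ^ j) f = 0 := by rw [hTj, hj]; rfl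
  set P := (minpoly k x).map (algebraMap k K) with hP
  have hPx : P.IsRoot x := by
    rw [hP, IsRoot.def, eval_map_algebraMap, minpoly.aeval]
  obtain ⟨Q, hQ⟩ := dvd_iff_isRoot.2 hPx
  have hsep : P.Separable := Separable.map hx
  have hcop : IsCoprime ((Polynomial.X - C x) ^ j) Q := by
    rw [hQ] at hsep
    exact hsep.isCoprime.pow_left
  obtain ⟨b, c, hbc⟩ := hcop
  have hPf : aeval X P f = 0 := by
    ext m
    rw [hX, hP, aeval_precomp_smul, minpoly.aeval, zero_smul, map_zero]
    rfl
  have hXT : aeval X (Polynomial.X - C x) = T := by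
    rw [map_sub, aeval_X, aeval_C, hT, Algebra.algebraMap_eq_smul_one]
  have hTf0 : T f = 0 := by
    -- The Bezout relation multiplied by `X - x`, with `P = (X - x) Q`: both terms on the right kill
    -- `f`.
    have e : Polynomial.X - C x =
        ((Polynomial.X - C x) * b) * (Polynomial.X - C x) ^ j + c * P := by
      rw [hQ]
      linear_combination (- (Polynomial.X - C x)) * hbc
    have e' := congrArg (fun p => aeval X p f) e
    simp only [map_add, map_mul, map_pow, LinearMap.add_apply, Module.End.mul_apply, hPf,
      hXT, hTj0, map_zero, add_zero] at e'
    exact e'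
  have := DFunLike.congr_fun hTf0 m
  exact sub_eq_zero.1 this

end Separable

/-! ### The functor from `S_K`-modules to `H`-modules, and its full faithfulness. -/

section Induce

variable {k K A : Type u} [Field k] [Field K] [Algebra k K] [CommRing A] [HopfAlgebra k A]
  (S : HopfSubalgebra k A)
  {M M' : Type u} [AddCommGroup M] [Module k M] [Module K M] [IsScalarTower k K M]
  [AddCommGroup M'] [Module k M'] [Module K M'] [IsScalarTower k K M']

variable (M) in
/-- The map from `M ⊗[K] (K ⊗[k] S)` to `M ⊗[k] A` given by the inclusion of `S` in `A`. -/
def extend : M ⊗[K] (K ⊗[k] S.Carrier) →ₗ[K] M ⊗[k] A :=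
  TensorProduct.AlgebraTensorModule.lTensor K M S.val.toLinearMap ∘ₗ
    (cancel k K S.Carrier M).toLinearMap

theorem extend_injective : Function.Injective (extend (k := k) (K := K) S M) :=
  (Module.Flat.lTensor_preserves_injective_linearMap S.val.toLinearMap
    Subtype.val_injective).comp (cancel k K S.Carrier M).injective

theorem extend_isCoaction {δ : M →ₗ[K] M ⊗[K] (K ⊗[k] S.Carrier)} :
    IsCoaction ((extend (k := k) S M ∘ₗ δ).restrictScalars k) ↔ IsCoaction δ := by
  rw [← isCoaction_cancel_iff]
  exact ⟨fun h => IsCoaction.of_lTensor S.valCoalgHom S.valCoalgHom_injective h,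
    fun h => h.lTensor S.valCoalgHom⟩

theorem extend_rTensor (f : M →ₗ[K] M') (z : M ⊗[K] (K ⊗[k] S.Carrier)) :
    extend S M' (f.rTensor _ z) = (f.restrictScalars k).rTensor A (extend S M z) := by
  induction z with
  | zero => simp
  | add x y hx hy => simp only [map_add, hx, hy]
  | tmul m y =>
    induction y with
    | zero => simp
    | add x y hx hy => simp only [TensorProduct.tmul_add, map_add, hx, hy]
    | tmul c a => simp [extend]

theorem tw_rTensor (g : K ⊗[k] A) (f : M →ₗ[K] M') (z : M ⊗[k] A) :
    tw M' g ((f.restrictScalars k).rTensor A z) =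
      (f.restrictScalars k).rTensor A (tw M g z) := by
  induction z with
  | zero => simp
  | add x y hx hy => simp only [map_add, hx, hy]
  | tmul m b =>
    induction g with
    | zero => simp [tw_zero]
    | add x y hx hy => simp only [tw_add, LinearMap.add_apply, map_add, hx, hy]
    | tmul c a => simp [tw_tmul_tmul]

theorem tw_injective {g : K ⊗[k] A} (hg : IsUnit g) : Function.Injective (tw M g) := by
  obtain ⟨h, hh⟩ := hg.exists_left_inv
  refine Function.LeftInverse.injective (g := tw M h) fun z => ?_
  rw [← LinearMap.comp_apply, ← tw_mul, hh, tw_one, LinearMap.id_apply]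

/-- Twisting by a unit and extending the coefficients from `S` to `A` are injective and natural in
`K`-linear maps. For fullness it thus remains only to prove `K`-linearity. -/
theorem comm_extend_iff {g : K ⊗[k] A} (hg : IsUnit g)
    {δ : M →ₗ[K] M ⊗[K] (K ⊗[k] S.Carrier)} {δ' : M' →ₗ[K] M' ⊗[K] (K ⊗[k] S.Carrier)}
    (f : M →ₗ[K] M') :
    (tw M' g ∘ₗ extend S M' ∘ₗ δ').restrictScalars k ∘ₗ f.restrictScalars k =
      (f.restrictScalars k).rTensor A ∘ₗ (tw M g ∘ₗ extend S M ∘ₗ δ).restrictScalars k ↔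
    δ' ∘ₗ f = f.rTensor _ ∘ₗ δ := by
  simp only [LinearMap.ext_iff, LinearMap.comp_apply, LinearMap.restrictScalars_apply,
    ← tw_rTensor, ← extend_rTensor, (tw_injective hg).eq_iff, (extend_injective S).eq_iff]

variable (k) in
/-- The underlying space of an `S_K`-module, regarded both over `k` and over `K`. -/
def Res (W : FinRep K (K ⊗[k] S.Carrier)) : Type u := W.carrier

instance (W : FinRep K (K ⊗[k] S.Carrier)) : AddCommGroup (Res k S W) := W.addCommGroup

instance (W : FinRep K (K ⊗[k] S.Carrier)) : Module K (Res k S W) := W.module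

instance (W : FinRep K (K ⊗[k] S.Carrier)) : Module k (Res k S W) :=
  Module.compHom (Res k S W) (algebraMap k K)

instance (W : FinRep K (K ⊗[k] S.Carrier)) : IsScalarTower k K (Res k S W) :=
  IsScalarTower.of_algebraMap_smul fun _ _ => rfl

instance [Module.Finite k K] (W : FinRep K (K ⊗[k] S.Carrier)) : Module.Finite k (Res k S W) :=
  have : Module.Finite K (Res k S W) := W.finite
  Module.Finite.trans K _

/-- The coaction of an `S_K`-module `W`, with the underlying space regarded over `k`. -/
def origCoact (W : FinRep K (K ⊗[k] S.Carrier)) : Res k S W →ₗ[K]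
    Res k S W ⊗[K] (K ⊗[k] S.Carrier) := W.coact

theorem origCoact_isCoaction (W : FinRep K (K ⊗[k] S.Carrier)) : IsCoaction (origCoact S W) :=
  W.isCoaction

variable (k) {S} in
/-- The `K`-linear map underlying a morphism of `S_K`-modules. -/
def resMap {W W' : FinRep K (K ⊗[k] S.Carrier)} (f : W ⟶ W') : Res k S W →ₗ[K] Res k S W' :=
  FinRep.lin f

theorem origCoact_comp_resMap {W W' : FinRep K (K ⊗[k] S.Carrier)} (f : W ⟶ W') :
    origCoact S W' ∘ₗ resMap k f = (resMap k f).rTensor _ ∘ₗ origCoact S W :=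
  FinRep.lin_comm f

variable {S} in
/-- A morphism of `S_K`-modules, given by its underlying linear map. -/
def homOfRes {W W' : FinRep K (K ⊗[k] S.Carrier)} (F : Res k S W →ₗ[K] Res k S W')
    (hF : origCoact S W' ∘ₗ F = F.rTensor _ ∘ₗ origCoact S W) : W ⟶ W' :=
  FinRep.ofLin (V := W) (W := W') F hF

variable [Module.Finite k K] {g : K ⊗[k] A} (hg : IsGroupLikeElem K g)

/-- The `H`-module that is obtained from a `K`-module with an action of the quotient group scheme
given by `S` upon multiplication by a character `g`, and restriction of scalars to `k`. -/
def induceObj (W : FinRep K (K ⊗[k] S.Carrier)) : FinRep k A :=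
  FinRep.ofCoaction (tw_isCoaction hg ((extend_isCoaction S).2 (origCoact_isCoaction S W)))

/-- The functor from `S_K`-modules to `H`-modules that is given by a character over `K`. -/
def induce : FinRep K (K ⊗[k] S.Carrier) ⥤ FinRep k A where
  obj := induceObj S hg
  map {W W'} f := FinRep.ofLin (V := induceObj S hg W) (W := induceObj S hg W')
    ((resMap k f).restrictScalars k)
    ((comm_extend_iff S hg.isUnit (resMap k f)).2 (origCoact_comp_resMap S f))
  map_id _ := rfl
  map_comp _ _ := rfl

instance induce_faithful : (induce S hg).Faithful where
  map_injective h := FinRep.lin_injective _ _ <| LinearMap.ext fun w =>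
    DFunLike.congr_fun (congrArg FinRep.lin h) w

/-- The action of a functional on an induced module, as a `K`-linear map. -/
def induceAct (W : FinRep K (K ⊗[k] S.Carrier)) (g : K ⊗[k] A) (φ : Module.Dual k A) :
    Module.End K (Res k S W) where
  toFun := act ((tw _ g ∘ₗ extend S _ ∘ₗ origCoact S W).restrictScalars k) φ
  map_add' := map_add _
  map_smul' := act_smul _ φ

/-- The untwisted module has coefficients in the component, so its filtration is exhaustive; after
the twist by `g`, the difference lowers that filtration by one step. -/
theorem isNilpotent_induceAct_sub (hS : S.toSubalgebra ≤ componentSubalgebra k A)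
    (W : FinRep K (K ⊗[k] S.Carrier)) (g : K ⊗[k] A) (φ : Module.Dual k A) :
    IsNilpotent (induceAct S W g φ - slice K φ g • 1) := by
  set δ := extend S (Res k S W) ∘ₗ origCoact S W with hδ
  have hc : IsCoaction (δ.restrictScalars k) :=
    (extend_isCoaction S).2 (origCoact_isCoaction S W)
  obtain ⟨n, hn⟩ := exists_fil_eq_top_of_coeff_mem hc fun f v => hS <|
    coeff_lTensor_val_mem S (((cancel k K S.Carrier _).toLinearMap ∘ₗ
      origCoact S W).restrictScalars k) f v
  refine ⟨n, LinearMap.ext fun w => ?_⟩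
  have h : ∀ m, ∀ w ∈ fil (δ.restrictScalars k) m,
      ((induceAct S W g φ - slice K φ g • 1) ^ m) w = 0 := by
    intro m
    induction m with
    | zero => exact fun w hw => hw
    | succ m ih =>
      intro w hw
      rw [pow_succ, Module.End.mul_apply]
      exact ih _ (act_tw_sub_mem_fil g hw φ)
  exact h n w (hn ▸ Submodule.mem_top)

/-- Each scalar of `K` is `g(φ)` for some `φ`, which acts on both modules as this scalar plus a
nilpotent. Separability then forces a morphism to commute with the scalar. -/
theorem induce_full (hS : S.toSubalgebra ≤ componentSubalgebra k A)
    (hsurj : ∀ x : K, ∃ φ, slice K φ g = x) [Algebra.IsSeparable k K] : (induce S hg).Full where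
  map_surjective {W W'} f := by
    let f' : Res k S W →ₗ[k] Res k S W' := FinRep.lin f
    have hlin : ∀ (c : K) (w : Res k S W), f' (c • w) = c • f' w := by
      intro c w
      obtain ⟨φ, rfl⟩ := hsurj c
      exact map_smul_of_isNilpotent_sub (Algebra.IsSeparable.isSeparable k _)
        (isNilpotent_induceAct_sub S hS W g φ) (isNilpotent_induceAct_sub S hS W' g φ)
        (f := f') (fun m => (FinRep.act_lin f φ m).symm) w
    let F : Res k S W →ₗ[K] Res k S W' :=
      { toFun := f'
        map_add' := map_add f'
        map_smul' := hlin }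
    exact ⟨homOfRes F ((comm_extend_iff S hg.isUnit F).1 (FinRep.lin_comm f)),
      FinRep.lin_injective _ _ rfl⟩

end Induce

/-! ### Slices as linear functions of the functional. -/

section Evaluation

variable {k : Type*} [Field k] {V C : Type*} [AddCommGroup V] [Module k V] [AddCommGroup C]
  [Module k C]

/-- Contraction of a fixed tensor, as a function of the functional. -/
def sliceHom (z : V ⊗[k] C) : Module.Dual k C →ₗ[k] V where
  toFun φ := slice V φ z
  map_add' φ ψ := by simp [slice, LinearMap.lTensor_add]
  map_smul' c φ := by simp [slice, LinearMap.lTensor_smul]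

theorem sliceHom_apply (z : V ⊗[k] C) (φ : Module.Dual k C) : sliceHom z φ = slice V φ z := rfl

end Evaluation

/-! ### Evaluation at a character, and simple modules. -/

section GroupLike

variable {k K A : Type u} [Field k] [Field K] [Algebra k K] [CommRing A] [HopfAlgebra k A]

/-- The comodule axioms at the vector `1` are the two group-like identities. This serves for `eltK`,
which is only chosen as a preimage of `χ` and is already known to define the comodule `ρ(χ)`. -/
theorem isGroupLikeElem_of_isCoaction {g : K ⊗[k] A} (h : IsCoaction (Character.mulMap g)) :
    IsGroupLikeElem K g := by
  let δ : K →ₗ[K] K ⊗[K] (K ⊗[k] A) :=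
    (cancel k K A K).symm.toLinearMap ∘ₗ LinearMap.toSpanSingleton K _ g
  have hcancel : ∀ z : K ⊗[k] A, cancel k K A K (1 ⊗ₜ z) = z := by
    intro z
    induction z with
    | zero => simp
    | add x y hx hy => rw [TensorProduct.tmul_add, map_add, hx, hy]
    | tmul c a => simp
  have hδ : IsCoaction δ := by
    rw [← isCoaction_cancel_iff, ← LinearMap.comp_assoc, LinearEquiv.comp_symm,
      LinearMap.id_comp]
    exact h
  have hδ1 : δ 1 = 1 ⊗ₜ g := by
    rw [LinearMap.comp_apply, LinearMap.toSpanSingleton_apply, one_smul, LinearEquiv.coe_coe,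
      LinearEquiv.symm_apply_eq, hcancel]
  refine ⟨(TensorProduct.lid K K).symm.injective ?_, (TensorProduct.lid K _).symm.injective ?_⟩
  · have := DFunLike.congr_fun hδ.counit 1
    rw [LinearMap.comp_apply, hδ1, LinearMap.lTensor_tmul] at this
    simpa using this
  · have := DFunLike.congr_fun hδ.coassoc 1
    change TensorProduct.assoc K K _ _ (δ.rTensor _ (δ 1)) = Coalgebra.comul.lTensor K (δ 1) at this
    rw [hδ1, LinearMap.lTensor_tmul, LinearMap.rTensor_tmul, hδ1] at this
    simpa using this.symm

theorem act_mulMap (g : K ⊗[k] A) (φ : Module.Dual k A) (c : K) :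
    act (Character.mulMap g) φ c = c * slice K φ g := by
  rw [act_apply, Character.mulMap_apply, slice_smul, smul_eq_mul]

/-- Evaluation at `g` is multiplicative on the convolution algebra; the order is immaterial in `K`.
-/
theorem slice_conv {g : K ⊗[k] A} (h : IsCoaction (Character.mulMap g))
    (φ ψ : Module.Dual k A) : slice K (conv φ ψ) g = slice K ψ g * slice K φ g := by
  have := h.act_act φ ψ 1
  simp only [act_mulMap, one_mul] at this
  exact this.symm

theorem slice_counit {g : K ⊗[k] A} (h : IsCoaction (Character.mulMap g)) :
    slice K Coalgebra.counit g = 1 := by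
  have := h.act_counit 1
  rwa [act_mulMap, one_mul] at this

/-- The iterates of a morphism intertwine the iterates of the actions. -/
theorem pow_apply_of_comm {V W : Type*} [AddCommGroup V] [Module k V] [AddCommGroup W]
    [Module k W] {a : Module.End k V} {b : Module.End k W} {f : V →ₗ[k] W}
    (h : ∀ v, b (f v) = f (a v)) (n : ℕ) (v : V) : (b ^ n) (f v) = f ((a ^ n) v) := by
  induction n generalizing v with
  | zero => rfl
  | succ n ih => rw [pow_succ, pow_succ, Module.End.mul_apply, Module.End.mul_apply, h, ih]

theorem FinRep.IsCompositionFactor.isNilpotent_act {X V : FinRep k A}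
    (h : X.IsCompositionFactor V) {φ : Module.Dual k A}
    (hφ : IsNilpotent (act V.coact φ : Module.End k V.carrier)) :
    IsNilpotent (act X.coact φ : Module.End k X.carrier) := by
  obtain ⟨-, Y, i, p, hi, hp⟩ := h
  obtain ⟨n, hn⟩ := hφ
  refine ⟨n, LinearMap.ext fun x => ?_⟩
  obtain ⟨y, rfl⟩ := hp x
  have hy : ((act Y.coact φ : Module.End k Y.carrier) ^ n) y = 0 := hi (by
    rw [← pow_apply_of_comm (fun v => FinRep.act_lin i φ v), hn, map_zero]
    rfl)
  rw [pow_apply_of_comm (fun v => FinRep.act_lin p φ v), hy, map_zero]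
  rfl

/-- A simple `H`-module on which the kernel of a surjective evaluation `𝒪(H)^* → K` at a character
acts by zero is isomorphic to `K` with the coaction given by this character. -/
theorem FinRep.IsSimple.nonempty_iso {X R : FinRep k A} (hX : X.IsSimple) {g : K ⊗[k] A}
    (e : K ≃ₗ[k] R.carrier) (he : ∀ φ c, act R.coact φ (e c) = e (c * slice K φ g))
    (hg : IsCoaction (Character.mulMap g)) (hsurj : ∀ x : K, ∃ φ, slice K φ g = x)
    (h : ∀ φ, slice K φ g = 0 → act X.coact φ = 0) : Nonempty (X ≅ R) := by
  have := hX.1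
  obtain ⟨x, hx⟩ := exists_ne (0 : X.carrier)
  obtain ⟨s, hs⟩ := (sliceHom g).exists_rightInverse_of_surjective
    (LinearMap.range_eq_top.2 hsurj)
  let F : K →ₗ[k] X.carrier := sliceHom (X.coact x) ∘ₗ s
  -- The orbit map `φ ↦ φ · x` factors through evaluation at `g`, so the choice of the section `s`
  -- does not matter.
  have hF : ∀ φ, F (slice K φ g) = act X.coact φ x := by
    intro φ
    have h1 : slice K (s (slice K φ g) - φ) g = 0 := by
      rw [← sliceHom_apply, map_sub, sub_eq_zero]
      exact DFunLike.congr_fun hs (slice K φ g)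
    have h2 := DFunLike.congr_fun (h _ h1) x
    rw [act_apply, ← sliceHom_apply, map_sub] at h2
    exact sub_eq_zero.1 h2
  have hcomm : ∀ φ c, act X.coact φ (F c) = F (c * slice K φ g) := by
    intro φ c
    obtain ⟨ψ, rfl⟩ := hsurj c
    rw [hF, X.isCoaction.act_act, ← slice_conv hg, hF]
  have hF1 : F 1 = x := by rw [← slice_counit hg, hF, X.isCoaction.act_counit]
  have hinj : Function.Injective F := by
    refine (injective_iff_map_eq_zero F).2 fun c hc => by_contra fun hc0 => hx ?_
    obtain ⟨φ, hφ⟩ := hsurj c⁻¹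
    rw [← hF1, ← mul_inv_cancel₀ hc0, ← hφ, ← hcomm, hc, map_zero]
  have hsur : Function.Surjective F := by
    rcases hX.2 (LinearMap.range F) (FinRep.isSubmodule_iff.2 fun φ v hv => by
      obtain ⟨c, rfl⟩ := hv
      exact ⟨_, (hcomm φ c).symm⟩) with h0 | h0
    · exact absurd (hF1.symm.trans (DFunLike.congr_fun (LinearMap.range_eq_bot.1 h0) 1)) hx
    · exact LinearMap.range_eq_top.1 h0
  refine ⟨(FinRep.isoOfAct (V := R) (W := X)
    (e.symm ≪≫ₗ LinearEquiv.ofBijective F ⟨hinj, hsur⟩) fun φ r => ?_).symm⟩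
  obtain ⟨c, rfl⟩ := e.surjective r
  rw [he]
  simp only [LinearEquiv.trans_apply, LinearEquiv.symm_apply_apply]
  exact hcomm φ c

variable [Coalgebra.IsCocomm k A]

/-- Schur's argument: by commutativity the kernel of `φ` is a submodule, and it is nonzero because
`φ` is nilpotent. -/
theorem FinRep.IsSimple.act_eq_zero {X : FinRep k A} (hX : X.IsSimple) {φ : Module.Dual k A}
    (h : IsNilpotent (act X.coact φ : Module.End k X.carrier)) : act X.coact φ = 0 := by
  have := hX.1
  rcases hX.2 (LinearMap.ker (act X.coact φ)) (FinRep.isSubmodule_iff.2 fun ψ v hv => by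
    rw [LinearMap.mem_ker] at hv ⊢
    rw [X.isCoaction.act_comm, hv, map_zero]) with h0 | h0
  · obtain ⟨n, hn⟩ := h
    have hinj : Function.Injective (act X.coact φ) := LinearMap.ker_eq_bot.1 h0
    have hpow : Function.Injective ((act X.coact φ : Module.End k X.carrier) ^ n) := by
      rw [Module.End.coe_pow]
      exact hinj.iterate n
    rw [hn] at hpow
    obtain ⟨x, y, hxy⟩ := exists_pair_ne X.carrier
    exact absurd (hpow (a₁ := x) (a₂ := y) rfl) hxy
  · exact LinearMap.ker_eq_top.1 h0

end GroupLike

/-! ### The values of functionals fill the field of definition. -/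

namespace Character

variable {k : Type u} [Field k] {A : Type u} [CommRing A] [HopfAlgebra k A]
  {kbar : Type u} [Field kbar] [Algebra k kbar] [Algebra.IsAlgebraic k kbar]
  (χ : Character k A kbar)

theorem isCoaction_mulMap_eltK : IsCoaction (mulMap χ.eltK) := χ.rep.isCoaction

theorem isGroupLikeElem_eltK : IsGroupLikeElem χ.fieldOfDefinition χ.eltK :=
  isGroupLikeElem_of_isCoaction χ.isCoaction_mulMap_eltK

/-- The values of the functionals on `A` at a character fill its field of definition. -/
theorem slice_eltK_surjective (x : χ.fieldOfDefinition) :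
    ∃ φ, slice χ.fieldOfDefinition φ χ.eltK = x := by
  let R : Subalgebra k χ.fieldOfDefinition :=
    { carrier := Set.range fun φ => slice χ.fieldOfDefinition φ χ.eltK
      mul_mem' := by
        rintro _ _ ⟨φ, rfl⟩ ⟨ψ, rfl⟩
        exact ⟨conv ψ φ, slice_conv χ.isCoaction_mulMap_eltK ψ φ⟩
      add_mem' := by
        rintro _ _ ⟨φ, rfl⟩ ⟨ψ, rfl⟩
        exact ⟨φ + ψ, map_add (sliceHom χ.eltK) φ ψ⟩
      algebraMap_mem' := fun c => ⟨c • Coalgebra.counit, by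
        have := map_smul (sliceHom χ.eltK) c Coalgebra.counit
        rw [sliceHom_apply, sliceHom_apply, slice_counit χ.isCoaction_mulMap_eltK] at this
        rw [Algebra.algebraMap_eq_smul_one]
        exact this⟩ }
  -- The values form a `k`-subalgebra of an algebraic extension, hence a field. The coordinates of
  -- `χ` are such values, so `χ` is defined over it and minimality of `k(χ)` applies.
  let L : IntermediateField k kbar := (R.map χ.fieldOfDefinition.val).toIntermediateField
    fun y hy => (R.map χ.fieldOfDefinition.val).inv_mem_of_algebraic (x := ⟨y, hy⟩)
      (Algebra.IsAlgebraic.isAlgebraic _)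
  have hL : χ.IsDefinedOver L := by
    let b := Module.Basis.ofVectorSpace k A
    rw [isDefinedOver_iff b]
    intro i
    have key : ∀ z : χ.fieldOfDefinition ⊗[k] A, (Algebra.TensorProduct.basis kbar b).repr
        (Algebra.TensorProduct.map χ.fieldOfDefinition.val (AlgHom.id k A) z) i =
        (slice χ.fieldOfDefinition (b.coord i) z : kbar) := by
      intro z
      induction z with
      | zero => simp
      | add x y hx hy => simp only [map_add, Finsupp.add_apply, hx, hy, AddMemClass.coe_add]
      | tmul c a =>
        rw [Algebra.TensorProduct.map_tmul, AlgHom.id_apply, Algebra.TensorProduct.basis_repr_tmul,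
          slice_tmul]
        simp [Algebra.smul_def, mul_comm]
    rw [← map_eltK, key]
    exact ⟨_, ⟨b.coord i, rfl⟩, rfl⟩
  have hle : χ.fieldOfDefinition ≤ L := sInf_le hL
  obtain ⟨y, ⟨φ, hφ⟩, hy⟩ := hle x.2
  exact ⟨φ, hφ.trans (Subtype.val_injective hy)⟩

end Character

/-! ### Simple submodules and nilpotence. -/

section Simple

variable {k A : Type u} [Field k] [CommRing A] [HopfAlgebra k A]

/-- The inclusion of a stable subspace. -/
def FinRep.subHom (V : FinRep k A) (N : Submodule k V.carrier)
    (hN : ∀ φ, ∀ v ∈ N, act V.coact φ v ∈ N) : V.sub N hN ⟶ V :=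
  FinRep.ofLin (V := V.sub N hN) N.subtype (subCoact_comm V.coact N hN)

/-- A nonzero stable subspace contains a simple one. -/
theorem FinRep.exists_isSimple_sub (V : FinRep k A) {N : Submodule k V.carrier}
    (hN : ∀ φ, ∀ v ∈ N, act V.coact φ v ∈ N) (h0 : N ≠ ⊥) :
    ∃ (P : Submodule k V.carrier) (hP : ∀ φ, ∀ v ∈ P, act V.coact φ v ∈ P), P ≤ N ∧
      (V.sub P hP).IsSimple := by
  obtain ⟨P, ⟨hPN, hP, hP0⟩, hmin⟩ := (wellFounded_lt (α := Submodule k V.carrier)).has_min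
    {P | P ≤ N ∧ (∀ φ, ∀ v ∈ P, act V.coact φ v ∈ P) ∧ P ≠ ⊥} ⟨N, le_rfl, hN, h0⟩
  refine ⟨P, hP, hPN, Submodule.nontrivial_iff_ne_bot.2 hP0, fun Q hQ => ?_⟩
  rw [or_iff_not_imp_left]
  intro hQ0
  rw [FinRep.isSubmodule_iff] at hQ
  let Q' : Submodule k P := Q
  have hle : Q'.map P.subtype ≤ P := Submodule.map_subtype_le P Q'
  have hnlt := hmin (Q'.map P.subtype) ⟨hle.trans hPN, by
    rintro φ _ ⟨q, hq, rfl⟩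
    exact ⟨_, hQ φ q hq, coe_act_subCoact V.coact P hP φ q⟩, fun h => hQ0
      (Submodule.map_injective_of_injective P.injective_subtype (h.trans (Submodule.map_bot _).symm))⟩
  have heq : Q'.map P.subtype = P := hle.eq_of_not_lt hnlt
  refine (Submodule.map_injective_of_injective P.injective_subtype ?_ : Q' = ⊤)
  rw [heq, Submodule.map_subtype_top]

theorem FinRep.isCompositionFactor_sub (V : FinRep k A) {P : Submodule k V.carrier}
    (hP : ∀ φ, ∀ v ∈ P, act V.coact φ v ∈ P) (h : (V.sub P hP).IsSimple) :
    (V.sub P hP).IsCompositionFactor V :=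
  ⟨h, V.sub P hP, V.subHom P hP, 𝟙 _, P.injective_subtype, Function.surjective_id⟩

/-- An endomorphism that vanishes on all simple submodules is nilpotent. -/
theorem FinRep.isNilpotent_of_simple (V : FinRep k A) (T : Module.End k V.carrier)
    (hT : ∀ φ v, act V.coact φ (T v) = T (act V.coact φ v))
    (h : ∀ (P : Submodule k V.carrier) (hP : ∀ φ, ∀ v ∈ P, act V.coact φ v ∈ P),
      (V.sub P hP).IsSimple → ∀ v ∈ P, T v = 0) : IsNilpotent T := by
  -- Fitting decomposition: a nonzero range of `T ^ (n + 1)` would contain a simple submodule, which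
  -- `T` kills, so that it also lies in the complementary kernel. The exponent `n + 1` guarantees at
  -- least one factor `T`.
  obtain ⟨n, hn⟩ := Filter.eventually_atTop.1 T.eventually_isCompl_ker_pow_range_pow
  have hc := hn (n + 1) n.le_succ
  refine ⟨n + 1, by_contra fun hne => ?_⟩
  have hstab : ∀ φ, ∀ v ∈ LinearMap.range (T ^ (n + 1)),
      act V.coact φ v ∈ LinearMap.range (T ^ (n + 1)) := by
    rintro φ _ ⟨v, rfl⟩
    refine ⟨act V.coact φ v, ?_⟩
    exact pow_apply_of_comm (f := act V.coact φ) (fun v => (hT φ v).symm) (n + 1) v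
  obtain ⟨P, hP, hle, hs⟩ := V.exists_isSimple_sub hstab
    fun h0 => hne (LinearMap.range_eq_bot.1 h0)
  have hker : P ≤ LinearMap.ker (T ^ (n + 1)) := fun v hv => by
    rw [LinearMap.mem_ker, pow_succ, Module.End.mul_apply, h P hP hs v hv, map_zero]
  have hbot : P = ⊥ := le_bot_iff.1 (hc.disjoint hker hle)
  exact Submodule.nontrivial_iff_ne_bot.1 hs.1 hbot

theorem FinRep.act_sub_smul_counit (V : FinRep k A) (φ : Module.Dual k A) :
    act V.coact (φ - φ 1 • Coalgebra.counit) = act V.coact φ - φ 1 • LinearMap.id := by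
  refine LinearMap.ext fun v => ?_
  have : act V.coact (φ - φ 1 • Coalgebra.counit) v =
      act V.coact φ v - φ 1 • act V.coact Coalgebra.counit v := by
    simp only [act_apply, ← sliceHom_apply, map_sub, map_smul]
  rw [this, V.isCoaction.act_counit]
  rfl

variable [Coalgebra.IsCocomm k A]

/-- If every functional `φ` acts as the scalar `φ 1` up to a nilpotent endomorphism, then the
filtration by fixed vectors is exhaustive. -/
theorem FinRep.exists_fil_eq_top_of_isNilpotent (V : FinRep k A)
    (h : ∀ φ : Module.Dual k A,
      IsNilpotent (act V.coact φ - φ 1 • LinearMap.id : Module.End k V.carrier)) :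
    ∃ n, fil V.coact n = ⊤ := by
  refine FinRep.exists_fil_eq_top_of_fixed V fun N hN hne => ?_
  let Q := V.quot N hN
  have hQ : (⊤ : Submodule k Q.carrier) ≠ ⊥ := by
    have : Nontrivial Q.carrier := Submodule.Quotient.nontrivial_iff.2 hne
    exact top_ne_bot
  obtain ⟨P, hP, -, hs⟩ := Q.exists_isSimple_sub (N := ⊤) (fun _ _ _ => trivial) hQ
  have hX : (Q.sub P hP).IsCompositionFactor Q := Q.isCompositionFactor_sub hP hs
  -- The preimage in `V` of the simple submodule `P` of `V ⧸ N` exhibits `P` as a subquotient of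
  -- `V`.
  have hXV : (Q.sub P hP).IsCompositionFactor V := by
    let Y := P.comap N.mkQ
    have hY : ∀ φ, ∀ v ∈ Y, act V.coact φ v ∈ Y := fun φ v hv => by
      rw [Submodule.mem_comap] at hv ⊢
      rw [← comm_coact_iff.1 (quotCoact_comm V.coact N hN) φ v]
      exact hP φ _ hv
    let p : Y →ₗ[k] P := N.mkQ.restrict fun v hv => hv
    refine ⟨hs, V.sub Y hY, V.subHom Y hY, FinRep.ofAct (V := V.sub Y hY) (W := Q.sub P hP) p
      fun φ y => Subtype.val_injective ?_, Y.injective_subtype, ?_⟩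
    · rw [coe_act_subCoact]
      refine (comm_coact_iff.1 (quotCoact_comm V.coact N hN) φ y).trans ?_
      exact congrArg N.mkQ (coe_act_subCoact V.coact Y hY φ y).symm
    · rintro ⟨x, hx⟩
      obtain ⟨v, rfl⟩ := N.mkQ_surjective x
      exact ⟨⟨v, hx⟩, rfl⟩
  have := hs.1
  obtain ⟨x, hx⟩ := exists_ne (0 : (Q.sub P hP).carrier)
  refine ⟨x.1, fun h0 => hx (Subtype.val_injective h0), fun φ => ?_⟩
  -- The functional `φ - φ(1) ε` acts nilpotently on `V`, hence on the subquotient, hence by zero as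
  -- this is simple.
  have hz : act (Q.sub P hP).coact φ - φ 1 • LinearMap.id = 0 := by
    rw [← FinRep.act_sub_smul_counit]
    refine hs.act_eq_zero (hXV.isNilpotent_act ?_)
    rw [FinRep.act_sub_smul_counit]
    exact h φ
  have hzx := DFunLike.congr_fun hz x
  rw [LinearMap.sub_apply, LinearMap.zero_apply, sub_eq_zero] at hzx
  exact (coe_act_subCoact Q.coact P hP φ x).symm.trans (congrArg Subtype.val hzx)

end Simple

/-! ### Lifting `K` into the endomorphisms of a module, and untwisting. -/

section Lift

open Polynomial
open scoped IsMulCommutative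

/-- An element whose image in a separable extension `K` of `k` generates `K` can be corrected by
nilpotents so that it generates a copy of `K`. -/
theorem exists_algHom_isNilpotent_sub {k K S : Type*} [Field k] [Field K] [Algebra k K]
    [CommRing S] [Algebra k S] (pb : PowerBasis k K) (hsep : IsSeparable k pb.gen) {s : S}
    (hs : IsNilpotent (aeval s (minpoly k pb.gen))) :
    ∃ σ : K →ₐ[k] S, IsNilpotent (s - σ pb.gen) := by
  obtain ⟨a, b, hab⟩ := (show (minpoly k pb.gen).Separable from hsep)
  -- Bezout for the minimal polynomial and its derivative: the former is nilpotent at `s`, so the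
  -- latter is a unit there and Newton iteration yields an exact root near `s`.
  have hunit : IsUnit (aeval s (derivative (minpoly k pb.gen))) := by
    have h1 : aeval s b * aeval s (derivative (minpoly k pb.gen)) =
        1 - aeval s a * aeval s (minpoly k pb.gen) := by
      rw [eq_sub_iff_add_eq, ← map_mul, ← map_mul, ← map_add, add_comm, hab, map_one]
    have h2 : IsUnit (1 - aeval s a * aeval s (minpoly k pb.gen)) :=
      ((Commute.all _ _).isNilpotent_mul_left hs).isUnit_one_sub
    rw [← h1] at h2
    exact isUnit_of_mul_isUnit_right h2
  obtain ⟨r, ⟨hr, hr0⟩, -⟩ := existsUnique_nilpotent_sub_and_aeval_eq_zero hs hunit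
  exact ⟨pb.lift r hr0, by rwa [pb.lift_gen]⟩

variable {k K A : Type u} [Field k] [Field K] [Algebra k K] [CommRing A] [HopfAlgebra k A]

/-- The algebra of endomorphisms of an `H`-module that is generated by the action of the dual of
`𝒪(H)`. -/
def FinRep.actAlgebra (V : FinRep k A) : Subalgebra k (Module.End k V.carrier) :=
  Algebra.adjoin k (Set.range (act V.coact))

theorem FinRep.act_mem_actAlgebra (V : FinRep k A) (φ : Module.Dual k A) :
    act V.coact φ ∈ V.actAlgebra := Algebra.subset_adjoin ⟨φ, rfl⟩

variable [Coalgebra.IsCocomm k A]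

instance (V : FinRep k A) : IsMulCommutative V.actAlgebra :=
  Algebra.isMulCommutative_adjoin k (by
    rintro _ ⟨φ, rfl⟩ _ ⟨ψ, rfl⟩
    exact LinearMap.ext fun v => V.isCoaction.act_comm φ ψ v)

theorem FinRep.actAlgebra_comm (V : FinRep k A) (s : V.actAlgebra) (φ : Module.Dual k A)
    (v : V.carrier) : act V.coact φ (s.1 v) = s.1 (act V.coact φ v) :=
  DFunLike.congr_fun (congrArg Subtype.val
    (mul_comm (⟨_, V.act_mem_actAlgebra φ⟩ : V.actAlgebra) s)) v

/-- If all simple submodules of `V` are given by a separable character with values in `K`, then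
`K` acts on `V` through the algebra generated by the dual of `𝒪(H)`, and every functional acts up
to nilpotents by its value at the character. -/
theorem FinRep.exists_algHom_actAlgebra (V : FinRep k A) {g : K ⊗[k] A} [Module.Finite k K]
    [Algebra.IsSeparable k K] (hsurj : ∀ x : K, ∃ φ, slice K φ g = x)
    (hV : ∀ (P : Submodule k V.carrier) (hP : ∀ φ, ∀ v ∈ P, act V.coact φ v ∈ P),
      (V.sub P hP).IsSimple → ∃ e : K ≃ₗ[k] P, ∀ φ c,
        act V.coact φ (e c : V.carrier) = e (c * slice K φ g)) :
    ∃ σ : K →ₐ[k] V.actAlgebra, ∀ φ, IsNilpotent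
      ((⟨act V.coact φ, V.act_mem_actAlgebra φ⟩ : V.actAlgebra) - σ (slice K φ g)) := by
  -- `Acts s x`: on every copy of `ρ(χ)` in `V`, the operator `s` is multiplication by `x`. The
  -- relation respects polynomial expressions, and `x = 0` forces `s` to be nilpotent because all
  -- simple submodules are such copies.
  let Acts (s : V.actAlgebra) (x : K) : Prop :=
    ∀ (P : Submodule k V.carrier) (e : K ≃ₗ[k] P),
      (∀ φ c, act V.coact φ (e c : V.carrier) = e (c * slice K φ g)) →
        ∀ c, s.1 (e c : V.carrier) = e (x * c)
  let a (φ : Module.Dual k A) : V.actAlgebra := ⟨act V.coact φ, V.act_mem_actAlgebra φ⟩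
  have hact : ∀ φ, Acts (a φ) (slice K φ g) := fun φ P e he c => by
    rw [mul_comm]
    exact he φ c
  have hsub : ∀ s s' x x', Acts s x → Acts s' x' → Acts (s - s') (x - x') := by
    intro s s' x x' h h' P e he c
    rw [sub_mul, map_sub, Submodule.coe_sub, ← h P e he c, ← h' P e he c]
    rfl
  have haeval : ∀ (p : k[X]) s x, Acts s x → Acts (aeval s p) (aeval x p) := by
    intro p s x h P e he c
    induction p using Polynomial.induction_on' with
    | add p q hp hq =>
      rw [map_add, map_add, add_mul, map_add, Submodule.coe_add, ← hp, ← hq]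
      rfl
    | monomial n b =>
      have hpow : ∀ c, (s ^ n).1 (e c : V.carrier) = e (x ^ n * c) := by
        induction n with
        | zero => intro c; simp
        | succ n ih =>
          intro c
          rw [pow_succ, pow_succ, mul_assoc, ← ih, ← h P e he c]
          rfl
      rw [aeval_monomial, aeval_monomial, ← Algebra.smul_def, ← Algebra.smul_def, smul_mul_assoc,
        map_smul, Submodule.coe_smul, ← hpow]
      rfl
  have hnil : ∀ s, Acts s 0 → IsNilpotent s := by
    intro s hs
    have h1 : IsNilpotent s.1 := V.isNilpotent_of_simple s.1 (V.actAlgebra_comm s)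
      fun P hP hsimple v hv => by
        obtain ⟨e, he⟩ := hV P hP hsimple
        obtain ⟨c, hc⟩ := e.surjective ⟨v, hv⟩
        have := hs P e he c
        rw [hc, zero_mul, map_zero] at this
        exact this
    obtain ⟨n, hn⟩ := h1
    exact ⟨n, Subtype.val_injective hn⟩
  let pb := Field.powerBasisOfFiniteOfSeparable k K
  -- A functional whose value at the character is a primitive element: its operator is the
  -- approximate root to be corrected.
  obtain ⟨φ, hφ⟩ := hsurj pb.gen
  have hgen : Acts (a φ) pb.gen := hφ ▸ hact φ
  have h0 : IsNilpotent (aeval (a φ) (minpoly k pb.gen)) :=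
    hnil _ (minpoly.aeval k pb.gen ▸ haeval (minpoly k pb.gen) _ _ hgen)
  obtain ⟨σ, hσ⟩ := exists_algHom_isNilpotent_sub pb (Algebra.IsSeparable.isSeparable k _) h0
  refine ⟨σ, fun ψ => ?_⟩
  -- With `g(ψ) = q(gen)`, the operator of `ψ` agrees with `q` of the approximate root, and that
  -- with `q` of the exact root, each modulo nilpotents.
  obtain ⟨q, hq⟩ := pb.exists_eq_aeval' (slice K ψ g)
  have h1 : IsNilpotent (a ψ - aeval (a φ) q) := hnil _ (by
    have := hsub _ _ _ _ (hact ψ) (haeval q _ _ hgen)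
    rwa [← hq, sub_self] at this)
  have h2 : IsNilpotent (aeval (a φ) q - aeval (σ pb.gen) q) :=
    isNilpotent_aeval_sub_of_isNilpotent_sub q hσ
  have := (Commute.all _ _).isNilpotent_add h1 h2
  rw [sub_add_sub_cancel, aeval_algHom_apply, ← hq] at this
  exact this

/-- The filtration by fixed vectors of the twist of a module by the inverse of a character is
exhaustive if every functional acts up to nilpotents by its value at the character. -/
theorem exists_fil_tw_eq_top {M : Type u} [AddCommGroup M] [Module k M] [Module K M]
    [IsScalarTower k K M] [Module.Finite k M] {S : Type*} [CommRing S] [Algebra k S]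
    (ι : S →ₐ[k] Module.End k M) (a : Module.Dual k A → S) (σ : K →ₐ[k] S)
    {δ : M →ₗ[K] M ⊗[k] A} (hδ : IsCoaction (δ.restrictScalars k))
    (ha : ∀ φ, ι (a φ) = act (δ.restrictScalars k) φ) (hσ : ∀ x m, ι (σ x) m = x • m)
    {g h : K ⊗[k] A} (hh : IsGroupLikeElem K h) (hg : h * g = 1)
    (hnil : ∀ φ, IsNilpotent (a φ - σ (slice K φ g))) :
    ∃ n, fil ((tw M h ∘ₗ δ).restrictScalars k) n = ⊤ := by
  refine FinRep.exists_fil_eq_top_of_isNilpotent (FinRep.ofCoaction (tw_isCoaction hh hδ))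
    fun φ => ?_
  have hmul : ∀ (c : K) (b : A) (z : K ⊗[k] A), slice K φ ((c ⊗ₜ b) * z) =
      c * slice K (φ ∘ₗ LinearMap.mulLeft k b) z := by
    intro c b z
    induction z with
    | zero => simp
    | add x y hx hy => simp only [mul_add, map_add, hx, hy]
    | tmul d b' => simp
  -- Stated for arbitrary `h` to allow induction on tensors. For `h = c ⊗ b` the operator is `c`
  -- times the nilpotent difference attached to `φ(b ·)`; at the inverse of `g`, the subtracted
  -- scalar becomes `φ(1)`.
  have key : ∀ h : K ⊗[k] A, ∃ s, IsNilpotent s ∧ ∀ m, ι s m =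
      slice M φ (tw M h (δ m)) - slice K φ (h * g) • m := by
    intro h
    induction h with
    | zero => exact ⟨0, IsNilpotent.zero, fun m => by simp [tw_zero]⟩
    | add x y hx hy =>
      obtain ⟨s, hs, hx⟩ := hx
      obtain ⟨t, ht, hy⟩ := hy
      refine ⟨s + t, (Commute.all _ _).isNilpotent_add hs ht, fun m => ?_⟩
      rw [map_add, LinearMap.add_apply, hx, hy, tw_add, LinearMap.add_apply, map_add, add_mul,
        map_add, add_smul]
      abel
    | tmul c b =>
      refine ⟨σ c * (a (φ ∘ₗ LinearMap.mulLeft k b) -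
        σ (slice K (φ ∘ₗ LinearMap.mulLeft k b) g)),
        (Commute.all _ _).isNilpotent_mul_left (hnil _), fun m => ?_⟩
      rw [map_mul, map_sub, ha, Module.End.mul_apply, hσ, LinearMap.sub_apply, hσ, slice_tw_tmul,
        hmul, smul_sub, mul_smul]
      rfl
  obtain ⟨s, hs, hsm⟩ := key h
  have e : ι s = act ((tw M h ∘ₗ δ).restrictScalars k) φ - φ 1 • LinearMap.id := by
    refine LinearMap.ext fun m => ?_
    rw [hsm, hg, Algebra.TensorProduct.one_def, slice_tmul, smul_assoc, one_smul]
    rfl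
  exact e ▸ hs.map ι

end Lift

/-! ### Recovering an `S_K`-module from its twist. -/

section EssSurj

variable {k K A : Type u} [Field k] [Field K] [Algebra k K] [CommRing A]
  [HopfAlgebra k A]

theorem exists_isGroupLikeElem_inv {g : K ⊗[k] A} (hg : IsGroupLikeElem K g) :
    ∃ h, IsGroupLikeElem K h ∧ h * g = 1 ∧ g * h = 1 :=
  ⟨HopfAlgebra.antipode K g, IsGroupLikeElem.antipode (R := K) (A := K ⊗[k] A) hg,
    IsGroupLikeElem.antipode_mul_cancel (R := K) (A := K ⊗[k] A) hg,
    IsGroupLikeElem.mul_antipode_cancel (R := K) (A := K ⊗[k] A) hg⟩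

variable [Module.Finite k K]

/-- A module on which `K` acts by endomorphisms comes from an `S_K`-module if the twist of its
coaction by the inverse character has coefficients in `S`. -/
theorem exists_induce_iso (S : HopfSubalgebra k A) {g h : K ⊗[k] A} (hg : IsGroupLikeElem K g)
    (hh : IsGroupLikeElem K h) (hgh : g * h = 1) (V : FinRep k A) [Module K V.carrier]
    [IsScalarTower k K V.carrier] {δ : V.carrier →ₗ[K] V.carrier ⊗[k] A}
    (hδ : δ.restrictScalars k = V.coact)
    (hS : ∀ f v, coeff ((tw V.carrier h ∘ₗ δ).restrictScalars k) f v ∈ S.toSubalgebra) :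
    ∃ W, Nonempty ((induce S hg).obj W ≅ V) := by
  have hc : IsCoaction (δ.restrictScalars k) := hδ ▸ V.isCoaction
  -- A linear retraction suffices to define the coaction over `S`: `hS` puts the twisted coaction in
  -- the range of `extend`, where `r` is a two-sided inverse.
  obtain ⟨r, hr⟩ := (extend (k := k) (K := K) S V.carrier).exists_leftInverse_of_injective
    (LinearMap.ker_eq_bot.2 (extend_injective S))
  let η : V.carrier →ₗ[K] V.carrier ⊗[K] (K ⊗[k] S.Carrier) := r ∘ₗ tw V.carrier h ∘ₗ δ
  have hη : extend S V.carrier ∘ₗ η = tw V.carrier h ∘ₗ δ := by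
    refine LinearMap.ext fun v => ?_
    obtain ⟨y, hy⟩ := (mem_range_lTensor_iff (N := Subalgebra.toSubmodule S.toSubalgebra)).2
      fun f => hS f v
    have hz : extend S V.carrier ((cancel k K S.Carrier V.carrier).symm y) =
        tw V.carrier h (δ v) := by
      refine Eq.trans ?_ hy
      exact congrArg (LinearMap.lTensor V.carrier S.val.toLinearMap)
        ((cancel k K S.Carrier V.carrier).apply_symm_apply y)
    rw [LinearMap.comp_apply, LinearMap.comp_apply, LinearMap.comp_apply, ← hz,
      ← LinearMap.comp_apply r, hr, LinearMap.id_apply]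
  have hηc : IsCoaction η := by
    rw [← extend_isCoaction S, hη]
    exact tw_isCoaction hh hc
  have : Module.Finite K V.carrier := Module.Finite.of_restrictScalars_finite k K V.carrier
  let W : FinRep K (K ⊗[k] S.Carrier) := FinRep.ofCoaction hηc
  let j : Res k S W →ₗ[K] V.carrier := LinearMap.id (R := K) (M := V.carrier)
  let e : Res k S W ≃ₗ[k] V.carrier :=
    { j.restrictScalars k with
      invFun := fun v => v
      left_inv := fun _ => rfl
      right_inv := fun _ => rfl }
  refine ⟨W, ⟨FinRep.isoOfAct (V := (induce S hg).obj W) (W := V) e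
    (comm_coact_iff.1 (LinearMap.ext fun w => ?_))⟩⟩
  have h1 : (j.restrictScalars k).rTensor A (tw _ g (extend S _ (origCoact S W w))) =
      tw V.carrier g (extend S V.carrier (j.rTensor _ (origCoact S W w))) := by
    rw [extend_rTensor, tw_rTensor]
  have h2 : j.rTensor _ (origCoact S W w) = η (j w) :=
    DFunLike.congr_fun (LinearMap.rTensor_id (R := K) (K ⊗[k] S.Carrier) V.carrier) (η (j w))
  have h3 : tw V.carrier g (extend S V.carrier (η (j w))) = V.coact (j w) := by
    rw [← LinearMap.comp_apply (extend S V.carrier), hη, LinearMap.comp_apply,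
      ← LinearMap.comp_apply (tw V.carrier g), ← tw_mul, hgh, tw_one, ← hδ]
    rfl
  exact (h1.trans ((congrArg (fun z => tw V.carrier g (extend S V.carrier z)) h2).trans h3)).symm

end EssSurj

/-! ### The image of the functor is the block. -/

namespace Character

open scoped IsMulCommutative

variable {k : Type u} [Field k] {A : Type u} [CommRing A] [HopfAlgebra k A]
  [Coalgebra.IsCocomm k A]
  {kbar : Type u} [Field kbar] [Algebra k kbar] [Algebra.IsAlgebraic k kbar]
  (χ : Character k A kbar)

/-- The composition factors of the modules induced from a unipotent quotient by `χ` are isomorphic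
to `ρ(χ)`. -/
theorem nonempty_iso_rep {S : HopfSubalgebra k A} (hS : S.toSubalgebra ≤ componentSubalgebra k A)
    (W : FinRep χ.fieldOfDefinition (χ.fieldOfDefinition ⊗[k] S.Carrier)) (X : FinRep k A)
    (hX : X.IsCompositionFactor ((induce S χ.isGroupLikeElem_eltK).obj W)) :
    Nonempty (X ≅ χ.rep) := by
  refine hX.1.nonempty_iso (R := χ.rep) (LinearEquiv.refl k χ.fieldOfDefinition)
    (act_mulMap χ.eltK) χ.isCoaction_mulMap_eltK χ.slice_eltK_surjective fun φ hφ =>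
    hX.1.act_eq_zero (hX.isNilpotent_act ?_)
  -- A functional vanishing at the character acts nilpotently on the induced module, hence by zero
  -- on a simple subquotient.
  obtain ⟨n, hn⟩ := isNilpotent_induceAct_sub S hS W χ.eltK φ
  rw [hφ, zero_smul, sub_zero] at hn
  refine ⟨n, LinearMap.ext fun w => ?_⟩
  refine Eq.trans ?_ (DFunLike.congr_fun hn w)
  clear hn
  induction n generalizing w with
  | zero => rfl
  | succ n ih =>
    rw [pow_succ]
    exact (ih _).trans (DFunLike.congr_fun (pow_succ (induceAct S W χ.eltK φ) n) w).symm

/-- The modules in the block of a separable character are induced from the largest unipotent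
quotient. -/
theorem exists_induce_iso_of_block (hχ : χ.IsSeparable) {S : HopfSubalgebra k A}
    (hS : componentSubalgebra k A ≤ S.toSubalgebra) (V : FinRep k A)
    (hV : ∀ X : FinRep k A, X.IsCompositionFactor V → Nonempty (X ≅ χ.rep)) :
    ∃ W, Nonempty ((induce S χ.isGroupLikeElem_eltK).obj W ≅ V) := by
  have : Algebra.IsSeparable k χ.fieldOfDefinition := hχ
  obtain ⟨σ, hσ⟩ := V.exists_algHom_actAlgebra χ.slice_eltK_surjective fun P hP hs => by
    obtain ⟨i⟩ := hV _ (V.isCompositionFactor_sub hP hs)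
    refine ⟨LinearEquiv.ofLinearMap (FinRep.lin i.inv) (FinRep.lin i.hom)
      (congrArg FinRep.lin i.hom_inv_id) (congrArg FinRep.lin i.inv_hom_id), fun φ c => ?_⟩
    have h1 := FinRep.act_lin i.inv φ c
    have h2 : act χ.rep.coact φ c = c * slice χ.fieldOfDefinition φ χ.eltK :=
      act_mulMap χ.eltK φ c
    rw [h2] at h1
    exact (coe_act_subCoact V.coact P hP φ _).symm.trans (congrArg Subtype.val h1)
  let τ : χ.fieldOfDefinition →ₐ[k] Module.End k V.carrier := V.actAlgebra.val.comp σ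
  let : Module χ.fieldOfDefinition V.carrier := Module.compHom V.carrier τ.toRingHom
  have hsmul : ∀ (x : χ.fieldOfDefinition) (v : V.carrier), x • v = (σ x).1 v := fun _ _ => rfl
  have : IsScalarTower k χ.fieldOfDefinition V.carrier :=
    IsScalarTower.of_algebraMap_smul fun c v => by
      rw [hsmul, σ.commutes]
      rfl
  -- The coaction is `K`-linear because `σ` takes values in the commutative algebra generated by the
  -- functionals.
  let δ : V.carrier →ₗ[χ.fieldOfDefinition] V.carrier ⊗[k] A :=
    { V.coact with
      map_smul' := fun x v => slice_ext fun φ => by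
        rw [RingHom.id_apply, slice_smul, hsmul, hsmul]
        exact V.actAlgebra_comm (σ x) φ v }
  obtain ⟨h, hh, hhg, hgh⟩ := exists_isGroupLikeElem_inv χ.isGroupLikeElem_eltK
  obtain ⟨n, hn⟩ := exists_fil_tw_eq_top V.actAlgebra.val
    (fun φ => ⟨act V.coact φ, V.act_mem_actAlgebra φ⟩) σ (δ := δ) V.isCoaction (fun φ => rfl)
    (fun _ _ => rfl) hh hhg hσ
  refine exists_induce_iso S χ.isGroupLikeElem_eltK hh hgh V (δ := δ) rfl fun f v => hS ⟨n, ?_⟩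
  exact (mem_fil_iff_coeff (tw_isCoaction (δ := δ) hh V.isCoaction)).1 (hn ▸ Submodule.mem_top) f

end Character

end AffGrp

end

/-! ### The equivalence. -/

theorem mainTheorem11
    (k : Type u) [Field k]
    (kbar : Type u) [Field kbar] [Algebra k kbar] [IsAlgClosure k kbar]
    (A : Type u) [CommRing A] [HopfAlgebra k A] [Coalgebra.IsCocomm k A]
    (χ : AffGrp.Character k A kbar) (hχ : χ.IsSeparable) :
    ∃ e : χ.Block ≌
        AffGrp.FinRep χ.fieldOfDefinition
          (χ.fieldOfDefinition ⊗[k] (AffGrp.unipotentQuotient k A).Carrier),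
      e.functor.Additive := by
  have : Algebra.IsSeparable k χ.fieldOfDefinition := hχ
  have hS := AffGrp.unipotentQuotient_toSubalgebra (k := k) (A := A)
  let F := AffGrp.induce (AffGrp.unipotentQuotient k A) χ.isGroupLikeElem_eltK
  have hfull : F.Full := AffGrp.induce_full _ _ hS.le χ.slice_eltK_surjective
  let P : ObjectProperty (AffGrp.FinRep k A) := fun V =>
    ∀ X : AffGrp.FinRep k A, X.IsCompositionFactor V → Nonempty (X ≅ χ.rep)
  let G : _ ⥤ χ.Block := P.lift F fun W X hX => χ.nonempty_iso_rep hS.le W X hX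
  have hGfull : G.Full := inferInstanceAs (P.lift F _).Full
  have hGfaithful : G.Faithful := inferInstanceAs (P.lift F _).Faithful
  have hGess : G.EssSurj := ⟨fun V => by
    obtain ⟨W, ⟨i⟩⟩ := χ.exists_induce_iso_of_block hχ hS.ge V.obj V.property
    exact ⟨W, ⟨P.isoMk i⟩⟩⟩
  have hGeq : G.IsEquivalence := {}
  have hGadd : G.Additive := ⟨rfl⟩
  have : G.asEquivalence.functor.Additive := hGadd
  -- The functor constructed runs from `U_K`-modules to the block, so the required equivalence is
  -- its inverse, which inherits additivity.
  exact ⟨G.asEquivalence.symm, G.asEquivalence.inverse_additive⟩
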